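/- Let $K$ be a field and let $\mathcal C$ be a skeletally small additive $K$-category in which idempotents split. Let $\operatorname{Mod}(\mathcal C)$ be the category of ($K$-linear) additive functors $\mathcal C^{\mathrm{op}}\to\operatorname{Mod}K$ and let $\operatorname{mod}\mathcal C$ be its full subcategory of finitely presented functors (cokernels of morphisms $\operatorname{Hom}_{\mathcal C}(-,A)\to\operatorname{Hom}_{\mathcal C}(-,B)$). Let $\operatorname{rad}_{\mathcal C}(X,Y)$ be the set of $f\colon X\to Y$ such that $gf$ is in the Jacobson radical of $\operatorname{End}_{\mathcal C}(X)$ for all $g\colon Y\to X$. Put $\operatorname{rad}^0_{\mathcal C}=\operatorname{Hom}_{\mathcal C}$, and let $\operatorname{rad}_{\mathcal C}^{n+1}=\operatorname{rad}_{\mathcal C}\cdot\operatorname{rad}_{\mathcal C}^{n}$ consist of the finite sums of composites $hg$ with $g\in\operatorname{rad}^{n}_{\mathcal C}(X,A)$ and $h\in\operatorname{rad}_{\mathcal C}(A,Y)$. For $F\in\operatorname{Mod}(\mathcal C)$ let $\operatorname{rad}^n_{\mathcal C}F\subseteq F$ be the subfunctor $(\operatorname{rad}^n_{\mathcal C}F)(M)=\sum_{X,\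 f\in\operatorname{rad}^n_{\mathcal C}(M,X)}\operatorname{Im}F(f)$. A functor $F$ in $\operatorname{Mod}(\mathcal C)$ is *weakly Koszul* if it has a projective resolution $\cdots\to P_1\to P_0\to F\to 0$ with all $P_j$ finitely generated projective such that, with $\Omega^{j+1}(F)=\operatorname{Ker}(P_j\to P_{j-1})$ (where $P_{-1}=F$), $$\operatorname{rad}_{\mathcal C}^{i+1}(P_j)\cap\Omega^{j+1}(F)=\operatorname{rad}_{\mathcal C}^{i}(\Omega^{j+1}(F))\qquad\text{for all } j\ge 0,\ i\ge 1.$$ The category $\mathcal C$ is *weakly Koszul* if it is Krull-Schmidt (every object is a finite direct sum of objects with local endomorphism rings), locally radical finite ($\operatorname{rad}^i_{\mathcal C}(A,B)/\operatorname{rad}^{i+1}_{\mathcal C}(A,B)$ is finite dimensional over $K$ for all $A,B$ and $i\ge 0$), and every simple functor in $\operatorname{Mod}(\mathcal C)$ is weakly Koszul. Suppose that $\mathcal C$ is weakly Koszul. Then: (1) If $0\to F_1\to F_2\to F_3\to 0$ is an exact sequence in $\operatorname{mod}\mathcal C$ such that $F_1$ and $F_2$ are weakly Koszul and $(\operatorname{rad}_{\mathcal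 C}^kF_2)\cap F_1=\operatorname{rad}_{\mathcal C}^kF_1$ for all $k\ge 0$, then $F_3$ is weakly Koszul. (2) If $F$ in $\operatorname{Mod}(\mathcal C)$ is weakly Koszul, then $\operatorname{rad}_{\mathcal C}F$ is weakly Koszul; in particular $\operatorname{rad}_{\mathcal C}F$ is finitely generated. -/

import Mathlib

open CategoryTheory CategoryTheory.Limits Opposite

universe w v u

namespace WeaklyKoszul

section Ideals

variable (K : Type w) [Field K] {C : Type u} [Category.{v} C] [Preadditive C] [Linear K C]

/-- The radical `rad_C(X, Y)`: all `f : X ⟶ Y` such that for every `g : Y ⟶ X` the composite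
`X ⟶ Y ⟶ X` lies in the Jacobson radical of the ring `End X`. -/
def rad (X Y : C) : Submodule K (X ⟶ Y) where
  carrier := {f | ∀ g : Y ⟶ X, (f ≫ g : End X) ∈ Ring.jacobson (End X)}
  zero_mem' := fun g => by
    rw [zero_comp]
    exact Submodule.zero_mem _
  add_mem' := fun {a b} ha hb g => by
    rw [Preadditive.add_comp]
    exact Submodule.add_mem _ (ha g) (hb g)
  smul_mem' := fun c f hf g => by
    have h := hf (c • g)
    rwa [Linear.comp_smul, ← Linear.smul_comp] at h

/-- The radical is closed under precomposition (so that it is an ideal, together with the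
evident closure under postcomposition). -/
theorem comp_mem_rad {X Y Z : C} (g : X ⟶ Y) {f : Y ⟶ Z} (hf : f ∈ rad K Y Z) :
    g ≫ f ∈ rad K X Z := by
  intro h
  rw [← Ideal.jacobson_bot]
  refine (Ideal.mem_jacobson_iff (R := End X)).2 fun (b : X ⟶ X) => ?_
  have h1 := hf (h ≫ b ≫ g)
  rw [← Ideal.jacobson_bot] at h1
  obtain ⟨z, hz2⟩ : ∃ z : Y ⟶ Y, (f ≫ h ≫ b ≫ g) ≫ z + z = 𝟙 Y := by
    obtain ⟨z, hz⟩ := (Ideal.mem_jacobson_iff (R := End Y)).1 h1 1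
    rw [mul_one] at hz
    exact ⟨z, sub_eq_zero.1 ((Submodule.mem_bot _).1 hz)⟩
  refine ⟨(𝟙 X - g ≫ z ≫ f ≫ h ≫ b : X ⟶ X), (Submodule.mem_bot _).2 ?_⟩
  have e : g ≫ ((f ≫ h ≫ b ≫ g) ≫ z + z) ≫ f ≫ h ≫ b = g ≫ f ≫ h ≫ b := by
    rw [hz2, Category.id_comp]
  simp only [Preadditive.add_comp, Preadditive.comp_add, Category.assoc] at e
  change ((g ≫ f) ≫ h) ≫ b ≫ (𝟙 X - g ≫ z ≫ f ≫ h ≫ b) + (𝟙 X - g ≫ z ≫ f ≫ h ≫ b) - 𝟙 X = 0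
  simp only [Preadditive.comp_sub, Category.comp_id, Category.assoc]
  rw [← e]
  abel

/-- The product `I J` of two ideals of the category, each given by its subspaces of the
Hom-spaces: finite sums of composites of a morphism `g` in `J(X, A)` followed by a morphism
`h` in `I(A, Y)`. (The spanning set is closed under scalars when `J` consists of subspaces, so
the span is the set of finite sums.) -/
def idealMul (I J : ∀ X Y : C, Submodule K (X ⟶ Y)) (X Y : C) : Submodule K (X ⟶ Y) :=
  Submodule.span K {f | ∃ (A : C) (g : X ⟶ A) (h : A ⟶ Y), g ∈ J X A ∧ h ∈ I A Y ∧ g ≫ h = f}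

/-- The powers of the radical: `rad^0 = Hom` and `rad^(n+1) = rad · rad^n`. -/
def radPow : ℕ → ∀ X Y : C, Submodule K (X ⟶ Y)
  | 0 => fun _ _ => ⊤
  | n + 1 => idealMul K (rad K) (radPow n)

variable (C)

/-- Every object is a finite direct sum of objects with local endomorphism rings. -/
def IsKrullSchmidt [HasFiniteBiproducts C] : Prop :=
  ∀ X : C, ∃ (n : ℕ) (Y : Fin n → C),
    (∀ i, IsLocalRing (End (Y i))) ∧ Nonempty (X ≅ ⨁ Y)

/-- Every quotient `rad^i(A, B) / rad^(i+1)(A, B)` is finite dimensional over `K`. -/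
def IsLocallyRadicalFinite : Prop :=
  ∀ (A B : C) (i : ℕ),
    Module.Finite K
      (↥(radPow K i A B) ⧸ (radPow K (i + 1) A B).submoduleOf (radPow K i A B))

end Ideals

section Functors

variable (K : Type w) [Field K] (C : Type u) [Category.{v} C] [Preadditive C] [Linear K C]

/-- The property of a functor `Cᵒᵖ ⥤ ModuleCat K` to be additive and `K`-linear on morphisms. -/
def isLinear : ObjectProperty (Cᵒᵖ ⥤ ModuleCat.{v} K) := fun F =>
  F.Additive ∧ ∀ ⦃X Y : C⦄ (r : K) (f : X ⟶ Y), F.map (r • f).op = r • F.map f.op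

/-- The category `Mod(C)` of (`K`-linear) additive functors from `Cᵒᵖ` to `K`-vector spaces. -/
abbrev FunMod := (isLinear K C).FullSubcategory

variable {K C}

/-- The value `F(X)`. -/
abbrev FunMod.val (F : FunMod K C) (X : C) : ModuleCat.{v} K := F.obj.obj (op X)

/-- The linear map `F(f) : F(Y) → F(X)` for `f : X ⟶ Y`. -/
abbrev FunMod.res (F : FunMod K C) {X Y : C} (f : X ⟶ Y) : F.val Y →ₗ[K] F.val X :=
  (F.obj.map f.op).hom

/-- The component `F(X) → G(X)` of a morphism `F ⟶ G` of `Mod(C)`. -/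
abbrev FunMod.comp {F G : FunMod K C} (η : F ⟶ G) (X : C) : F.val X →ₗ[K] G.val X :=
  (η.hom.app (op X)).hom

variable (K) in
/-- The representable functor `Hom_C(-, B)`. -/
def homFunctor (B : C) : FunMod K C where
  obj := (linearYoneda K C).obj B
  property := by
    refine ⟨inferInstance, fun X Y r f => ?_⟩
    ext g
    exact Linear.smul_comp _ _ _ r f g

/-- `F` is finitely generated: there is an epimorphism `Hom_C(-, B) → F`. -/
def IsFinitelyGenerated (F : FunMod K C) : Prop :=
  ∃ (B : C) (p : homFunctor K B ⟶ F), ∀ X, Function.Surjective (FunMod.comp p X)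

/-- `F` is finitely presented, that is, an object of `mod(C)`: there is an exact sequence
`Hom_C(-, A) → Hom_C(-, B) → F → 0`. -/
def IsFinitelyPresented (F : FunMod K C) : Prop :=
  ∃ (A B : C) (q : homFunctor K A ⟶ homFunctor K B) (p : homFunctor K B ⟶ F),
    ∀ X, Function.Exact (FunMod.comp q X) (FunMod.comp p X) ∧
      Function.Surjective (FunMod.comp p X)

/-- `0 → F₁ → F₂ → F₃ → 0` is exact (exactness in a functor category is objectwise). -/
def IsShortExact {F₁ F₂ F₃ : FunMod K C} (a : F₁ ⟶ F₂) (b : F₂ ⟶ F₃) : Prop :=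
  ∀ X, Function.Injective (FunMod.comp a X) ∧
    Function.Exact (FunMod.comp a X) (FunMod.comp b X) ∧
    Function.Surjective (FunMod.comp b X)

/-- For an ideal `I` and a subfunctor `N` of `F` (given by its subspaces `N(X) ⊆ F(X)`), the
values of the subfunctor `I N`, namely `(I N)(M) = ∑ F(f)(N(X))` over all `X` and all
`f ∈ I(M, X)`. With `N = ⊤` this is `I F`. -/
def idealAct (I : ∀ X Y : C, Submodule K (X ⟶ Y)) (F : FunMod K C)
    (N : ∀ X, Submodule K (F.val X)) (M : C) : Submodule K (F.val M) :=
  ⨆ (X : C) (f : M ⟶ X) (_ : f ∈ I M X), (N X).map (F.res f)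

/-- The values of the subfunctor `rad^k F` of `F`. -/
def radPowSub (k : ℕ) (F : FunMod K C) (X : C) : Submodule K (F.val X) :=
  idealAct (radPow K k) F (fun _ => ⊤) X

theorem res_mem_idealAct_rad (F : FunMod K C) {X Y : C} (g : X ⟶ Y) (x : F.val Y)
    (hx : x ∈ idealAct (rad K) F (fun _ => ⊤) Y) :
    F.res g x ∈ idealAct (rad K) F (fun _ => ⊤) X := by
  have key : idealAct (rad K) F (fun _ => ⊤) Y ≤
      (idealAct (rad K) F (fun _ => ⊤) X).comap (F.res g) := by
    refine iSup_le fun Z => iSup_le fun f => iSup_le fun hf => ?_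
    rintro _ ⟨z, -, rfl⟩
    refine Submodule.mem_iSup_of_mem Z (Submodule.mem_iSup_of_mem (g ≫ f)
      (Submodule.mem_iSup_of_mem (comp_mem_rad K g hf) ⟨z, trivial, ?_⟩))
    simp [FunMod.res]
  exact key hx

/-- The subfunctor `rad F` of `F`, as an object of `Mod(C)`. -/
def radFunctor (F : FunMod K C) : FunMod K C where
  obj :=
    { obj := fun X => ModuleCat.of K ↥(idealAct (rad K) F (fun _ => ⊤) X.unop)
      map := fun {X Y} g => ModuleCat.ofHom
        ((F.res g.unop).restrict fun x hx => res_mem_idealAct_rad F g.unop x hx)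
      map_id := fun X => by
        ext x
        simp [FunMod.res]
      map_comp := fun f g => by
        ext x
        simp [FunMod.res] }
  property := by
    obtain ⟨hadd, hlin⟩ := F.property
    refine ⟨⟨fun {X Y f g} => ?_⟩, fun X Y r f => ?_⟩
    · ext x
      simp [FunMod.res, F.obj.map_add]
    · ext x
      have := congrArg (fun t => t.hom x.1) (hlin r f)
      simpa [FunMod.res] using this

/-- A projective resolution `⋯ → P₂ → P₁ → P₀ → F → 0` of `F` in `Mod(C)` by finitely
generated projective objects. -/
structure FGProjResolution (F : FunMod K C) where
  /-- the terms of the resolution -/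
  P : ℕ → FunMod K C
  /-- the differentials -/
  d : ∀ n, P (n + 1) ⟶ P n
  /-- the augmentation -/
  ε : P 0 ⟶ F
  fg : ∀ n, IsFinitelyGenerated (P n)
  projective : ∀ n, Projective (P n)
  surjective : ∀ X, Function.Surjective (FunMod.comp ε X)
  exact_zero : ∀ X, Function.Exact (FunMod.comp (d 0) X) (FunMod.comp ε X)
  exact_succ : ∀ n X, Function.Exact (FunMod.comp (d (n + 1)) X) (FunMod.comp (d n) X)

/-- The syzygies of a resolution as subfunctors: `R.syzygy j` is `Ω^(j+1)(F) ⊆ P_j`, the kernel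
of `P_j → P_(j-1)` (with `P_(-1) = F`). -/
def FGProjResolution.syzygy {F : FunMod K C} (R : FGProjResolution F) :
    ∀ (j : ℕ) (X : C), Submodule K ((R.P j).val X)
  | 0, X => LinearMap.ker (FunMod.comp R.ε X)
  | j + 1, X => LinearMap.ker (FunMod.comp (R.d j) X)

/-- `F` is weakly Koszul: it has a resolution by finitely generated projectives with
`rad^(i+1)(P_j) ∩ Ω^(j+1)(F) = rad^i(Ω^(j+1)(F))` for all `j ≥ 0` and `i ≥ 1`. -/
def IsWeaklyKoszul (F : FunMod K C) : Prop :=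
  ∃ R : FGProjResolution F, ∀ (j i : ℕ), 1 ≤ i → ∀ X : C,
    radPowSub (i + 1) (R.P j) X ⊓ R.syzygy j X =
      idealAct (radPow K i) (R.P j) (R.syzygy j) X

variable (K C) in
/-- The additive `K`-category `C` is weakly Koszul: it is Krull-Schmidt and locally radical
finite, and every simple object of `Mod(C)` is weakly Koszul. -/
structure IsWeaklyKoszulCategory [HasFiniteBiproducts C] : Prop where
  krullSchmidt : IsKrullSchmidt C
  locallyRadicalFinite : IsLocallyRadicalFinite K C
  simple : ∀ S : FunMod K C, Simple S → IsWeaklyKoszul S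

end Functors

end WeaklyKoszul

/-! Call a monomorphism `κ : Ω ⟶ P` good if rad^(i+1) P ∩ Ω = rad^i Ω for i ≥ 1, and `a : F ⟶ G`
rad-pure if rad^k G ∩ F = rad^k F for all k. Weak Koszulity is coinductive: it suffices that every
member of a class has a representable cover whose kernel is good and again in the class
(`isWeaklyKoszul_of_coinduction`). Conversely, over a Krull-Schmidt category every finitely
generated functor has a minimal cover, and a minimal cover is a retract of any projective cover. So
for weakly Koszul F the kernel of any minimal cover is good and weakly Koszul
(`IsWeaklyKoszul.kernel`), whatever resolution was given.

For (1), rad-purity makes minimal covers of F₁ and F₃ assemble to a minimal cover of F₂. The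
resulting sequence of kernels is exact and again rad-pure, because goodness of the first column and
splitness of the projective row shift the radical degree down by one. Goodness passes from the
middle column to the right one, and the sequence of kernels satisfies the same hypotheses, so
coinduction applies. The same diagram shows that the middle term inherits weak Koszulity from the
outer two.

For (2), a minimal cover P → F with kernel Ω gives an exact sequence 0 → Ω → rad P → rad F → 0.
Since rad^k(rad P) = rad^(k+1) P, goodness of Ω in P is exactly rad-purity of Ω in rad P. By (1) it
remains to treat rad P. When P is represented by an object with local endomorphism ring, P / rad P
is simple and rad P is its first syzygy; direct sums follow from closure under middle terms. -/

namespace WeaklyKoszul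

/-! ### Pointwise calculus in Mod(C): Yoneda, subfunctors, quotients, monos and epis -/

section Basics

variable {K : Type w} [Field K] {C : Type u} [Category.{v} C] [Preadditive C] [Linear K C]

namespace FunMod

theorem hom_ext' {F G : FunMod K C} {η θ : F ⟶ G}
    (h : ∀ X (x : F.val X), comp η X x = comp θ X x) : η = θ := by
  apply ObjectProperty.hom_ext
  ext X x
  exact h X.unop x

theorem comp_res {F G : FunMod K C} (η : F ⟶ G) {X Y : C} (f : X ⟶ Y) (x : F.val Y) :
    comp η X (F.res f x) = G.res f (comp η Y x) := by
  have := congrArg (fun t => t.hom x) (η.hom.naturality f.op)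
  exact this

@[simp]
theorem comp_comp {F G H : FunMod K C} (η : F ⟶ G) (θ : G ⟶ H) (X : C) (x : F.val X) :
    comp (η ≫ θ) X x = comp θ X (comp η X x) := rfl

@[simp]
theorem comp_id (F : FunMod K C) (X : C) (x : F.val X) : comp (𝟙 F) X x = x := rfl

@[simp]
theorem comp_zero (F G : FunMod K C) (X : C) (x : F.val X) : comp (0 : F ⟶ G) X x = 0 := rfl

/-- A morphism of `Mod(C)` from a natural family of linear maps. -/
def mkHom {F G : FunMod K C} (φ : ∀ X, F.val X →ₗ[K] G.val X)
    (h : ∀ {X Y : C} (f : X ⟶ Y) (x : F.val Y), φ X (F.res f x) = G.res f (φ Y x)) : F ⟶ G :=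
  ObjectProperty.homMk
    { app := fun X => ModuleCat.ofHom (φ X.unop)
      naturality := fun X Y f => by
        ext x
        exact h f.unop x }

theorem res_id (F : FunMod K C) (X : C) (x : F.val X) : F.res (𝟙 X) x = x := by
  simp [res]

theorem res_comp (F : FunMod K C) {X Y Z : C} (f : X ⟶ Y) (g : Y ⟶ Z) (x : F.val Z) :
    F.res (f ≫ g) x = F.res f (F.res g x) := by
  simp [res]

theorem res_add (F : FunMod K C) {X Y : C} (f g : X ⟶ Y) (x : F.val Y) :
    F.res (f + g) x = F.res f x + F.res g x := by
  have := F.property.1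
  simp [res, F.obj.map_add]

theorem res_smul (F : FunMod K C) {X Y : C} (r : K) (f : X ⟶ Y) (x : F.val Y) :
    F.res (r • f) x = r • F.res f x :=
  congrArg (fun t => t.hom x) (F.property.2 r f)

/-- The map `f ↦ F(f)(x)`. -/
def evalRes (F : FunMod K C) {B : C} (x : F.val B) (X : C) : (X ⟶ B) →ₗ[K] F.val X where
  toFun f := F.res f x
  map_add' f g := res_add F f g x
  map_smul' r f := res_smul F r f x

variable (K) in
/-- Morphisms `X ⟶ B` as elements of `Hom_C(-, B)(X)`. -/
def elt (X B : C) : (X ⟶ B) ≃ₗ[K] (homFunctor K B).val X := LinearEquiv.refl K _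

theorem res_elt {B X Y : C} (f : X ⟶ Y) (g : Y ⟶ B) :
    (homFunctor K B).res f (elt K Y B g) = elt K X B (f ≫ g) := rfl

/-- The morphism `Hom_C(-, B) → F` given by an element of `F(B)`. -/
def ofElement (F : FunMod K C) {B : C} (x : F.val B) : homFunctor K B ⟶ F :=
  mkHom (fun X => evalRes F x X) (fun f g => res_comp F f g x)

@[simp]
theorem comp_ofElement (F : FunMod K C) {B : C} (x : F.val B) (X : C) (f : X ⟶ B) :
    comp (ofElement F x) X (elt K X B f) = F.res f x := rfl

theorem comp_elt {F : FunMod K C} {B : C} (p : homFunctor K B ⟶ F) (X : C) (f : X ⟶ B) :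
    comp p X (elt K X B f) = F.res f (comp p B (elt K B B (𝟙 B))) := by
  rw [← comp_res, res_elt, Category.comp_id]

theorem hom_ext_id {F : FunMod K C} {B : C} {p q : homFunctor K B ⟶ F}
    (h : comp p B (elt K B B (𝟙 B)) = comp q B (elt K B B (𝟙 B))) : p = q :=
  hom_ext' fun X x => by
    obtain ⟨f, rfl⟩ := (elt K X B).surjective x
    rw [comp_elt p, comp_elt q, h]

/-- The morphism of representable functors induced by a morphism of `C`. -/
def homMap {A B : C} (f : A ⟶ B) : homFunctor K A ⟶ homFunctor K B :=
  ofElement (homFunctor K B) (elt K A B f)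

@[simp]
theorem comp_homMap {A B : C} (f : A ⟶ B) (X : C) (g : X ⟶ A) :
    comp (homMap (K := K) f) X (elt K X A g) = elt K X B (g ≫ f) := rfl

/-- A subfunctor as an object of `Mod(C)`. -/
def sub (F : FunMod K C) (N : ∀ X, Submodule K (F.val X))
    (hN : ∀ {X Y : C} (f : X ⟶ Y) (x : F.val Y), x ∈ N Y → F.res f x ∈ N X) : FunMod K C where
  obj :=
    { obj := fun X => ModuleCat.of K (N X.unop)
      map := fun {X Y} g => ModuleCat.ofHom ((F.res g.unop).restrict fun x hx => hN g.unop x hx)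
      map_id := fun X => by
        refine ModuleCat.hom_ext (LinearMap.ext fun (x : N X.unop) => Subtype.ext ?_)
        exact (res_id F X.unop x.1)
      map_comp := fun {X Y Z} f g => by
        refine ModuleCat.hom_ext (LinearMap.ext fun (x : N X.unop) => Subtype.ext ?_)
        exact (res_comp F g.unop f.unop x.1) }
  property := by
    refine ⟨⟨fun {X Y f g} => ?_⟩, fun X Y r f => ?_⟩
    · refine ModuleCat.hom_ext (LinearMap.ext fun (x : N X.unop) => Subtype.ext ?_)
      exact (res_add F f.unop g.unop x.1)
    · refine ModuleCat.hom_ext (LinearMap.ext fun (x : N Y) => Subtype.ext ?_)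
      exact (res_smul F r f x.1)

/-- The inclusion of a subfunctor. -/
def subι (F : FunMod K C) (N : ∀ X, Submodule K (F.val X))
    (hN : ∀ {X Y : C} (f : X ⟶ Y) (x : F.val Y), x ∈ N Y → F.res f x ∈ N X) : sub F N hN ⟶ F :=
  mkHom (fun X => (N X).subtype) (fun _ _ => rfl)

/-- The quotient by a subfunctor as an object of `Mod(C)`. -/
def quot (F : FunMod K C) (N : ∀ X, Submodule K (F.val X))
    (hN : ∀ {X Y : C} (f : X ⟶ Y) (x : F.val Y), x ∈ N Y → F.res f x ∈ N X) : FunMod K C where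
  obj :=
    { obj := fun X => ModuleCat.of K (F.val X.unop ⧸ N X.unop)
      map := fun {X Y} g => ModuleCat.ofHom
        ((N X.unop).mapQ (N Y.unop) (F.res g.unop) fun x hx => hN g.unop x hx)
      map_id := fun X => by
        refine ModuleCat.hom_ext (LinearMap.ext fun (x : F.val X.unop ⧸ N X.unop) => ?_)
        obtain ⟨x, rfl⟩ := Submodule.Quotient.mk_surjective _ x
        exact congrArg (Submodule.Quotient.mk (p := N X.unop)) (res_id F X.unop x)
      map_comp := fun {X Y Z} f g => by
        refine ModuleCat.hom_ext (LinearMap.ext fun (x : F.val X.unop ⧸ N X.unop) => ?_)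
        obtain ⟨x, rfl⟩ := Submodule.Quotient.mk_surjective _ x
        exact congrArg (Submodule.Quotient.mk (p := N Z.unop)) (res_comp F g.unop f.unop x) }
  property := by
    refine ⟨⟨fun {X Y f g} => ?_⟩, fun X Y r f => ?_⟩
    · refine ModuleCat.hom_ext (LinearMap.ext fun (x : F.val X.unop ⧸ N X.unop) => ?_)
      obtain ⟨x, rfl⟩ := Submodule.Quotient.mk_surjective _ x
      exact congrArg (Submodule.Quotient.mk (p := N Y.unop)) (res_add F f.unop g.unop x)
    · refine ModuleCat.hom_ext (LinearMap.ext fun (x : F.val Y ⧸ N Y) => ?_)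
      obtain ⟨x, rfl⟩ := Submodule.Quotient.mk_surjective _ x
      exact congrArg (Submodule.Quotient.mk (p := N X)) (res_smul F r f x)

/-- The projection to the quotient by a subfunctor. -/
def quotπ (F : FunMod K C) (N : ∀ X, Submodule K (F.val X))
    (hN : ∀ {X Y : C} (f : X ⟶ Y) (x : F.val Y), x ∈ N Y → F.res f x ∈ N X) : F ⟶ quot F N hN :=
  mkHom (fun X => (N X).mkQ) (fun _ _ => rfl)

theorem comp_quotπ (F : FunMod K C) (N : ∀ X, Submodule K (F.val X))
    (hN : ∀ {X Y : C} (f : X ⟶ Y) (x : F.val Y), x ∈ N Y → F.res f x ∈ N X) (X : C) :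
    comp (quotπ F N hN) X = (N X).mkQ := rfl

/-- The quotient of `G` by the pointwise image is again a linear functor, and its projection agrees
with zero after `e`; cancelling `e` kills the quotient. -/
theorem surjective_of_epi {F G : FunMod K C} (e : F ⟶ G) [Epi e] (X : C) :
    Function.Surjective (comp e X) := by
  have hN : ∀ {X Y : C} (f : X ⟶ Y) (x : G.val Y), x ∈ LinearMap.range (comp e Y) →
      G.res f x ∈ LinearMap.range (comp e X) := by
    rintro X Y f _ ⟨y, rfl⟩
    exact ⟨F.res f y, comp_res e f y⟩
  have h : e ≫ quotπ G (fun X => LinearMap.range (comp e X)) hN = e ≫ 0 :=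
    hom_ext' fun X x => by
      rw [comp_comp, comp_quotπ, comp_comp, comp_zero]
      exact (Submodule.Quotient.mk_eq_zero _).2 ⟨x, rfl⟩
  rw [cancel_epi] at h
  intro y
  have hy : comp (quotπ G (fun X => LinearMap.range (comp e X)) hN) X y = 0 := by
    rw [h, comp_zero]
  exact (Submodule.Quotient.mk_eq_zero _).1 hy

theorem epi_of_surjective {F G : FunMod K C} (e : F ⟶ G)
    (h : ∀ X, Function.Surjective (comp e X)) : Epi e where
  left_cancellation g k hgk := hom_ext' fun X y => by
    obtain ⟨x, rfl⟩ := h X y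
    exact congrArg (fun t => comp t X x) hgk

/-- By Yoneda, elements of `F(X)` are morphisms out of a representable, which `m` cancels. -/
theorem injective_of_mono {F G : FunMod K C} (m : F ⟶ G) [Mono m] (X : C) :
    Function.Injective (comp m X) := by
  intro x y hxy
  have h : ofElement F x ≫ m = ofElement F y ≫ m := hom_ext_id (by
    simp only [comp_comp, comp_ofElement, res_id, hxy])
  rw [cancel_mono] at h
  have := congrArg (fun t => comp t X (elt K X X (𝟙 X))) h
  simpa only [comp_ofElement, res_id] using this

instance projective_homFunctor (B : C) : Projective (homFunctor K B) where
  factors {E G} f e _ := by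
    obtain ⟨x, hx⟩ := surjective_of_epi e B (comp f B (elt K B B (𝟙 B)))
    exact ⟨ofElement E x, hom_ext_id (by rw [comp_comp, comp_ofElement, res_id, hx])⟩

theorem exists_lift {P F G : FunMod K C} [Projective P] (f : P ⟶ G) (e : F ⟶ G)
    (h : ∀ X, Function.Surjective (comp e X)) : ∃ f' : P ⟶ F, f' ≫ e = f :=
  have := epi_of_surjective e h
  ⟨Projective.factorThru f e, Projective.factorThru_comp f e⟩

/-- A morphism whose values lie in the image of a monomorphism factors through it. -/
theorem exists_factor {F G H : FunMod K C} (m : F ⟶ H) (hm : ∀ X, Function.Injective (comp m X))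
    (f : G ⟶ H) (hf : ∀ X x, comp f X x ∈ LinearMap.range (comp m X)) :
    ∃ f' : G ⟶ F, f' ≫ m = f := by
  have key : ∀ X x, comp m X ((LinearEquiv.ofInjective _ (hm X)).symm ⟨comp f X x, hf X x⟩) =
      comp f X x := fun X x =>
    congrArg Subtype.val ((LinearEquiv.ofInjective _ (hm X)).apply_symm_apply ⟨comp f X x, hf X x⟩)
  refine ⟨mkHom (fun X => (LinearEquiv.ofInjective _ (hm X)).symm.toLinearMap ∘ₗ
    (comp f X).codRestrict _ (hf X)) fun {X Y} g x => ?_, hom_ext' fun X x => ?_⟩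
  · apply hm X
    rw [comp_res]
    exact (key X _).trans ((comp_res f g x).trans (congrArg _ (key Y x).symm))
  · exact key X x

theorem isIso_of_bijective {F G : FunMod K C} (f : F ⟶ G)
    (h : ∀ X, Function.Bijective (comp f X)) : IsIso f := by
  obtain ⟨g, hg⟩ := exists_factor f (fun X => (h X).1) (𝟙 G) fun X x => (h X).2 x
  refine ⟨g, hom_ext' fun X x => (h X).1 ?_, hg⟩
  exact congrArg (fun t => comp t X (comp f X x)) hg

end FunMod

end Basics

/-! ### The radical of the category and its action on functors -/

section Radical

variable {K : Type w} [Field K] {C : Type u} [Category.{v} C] [Preadditive C] [Linear K C]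

theorem rad_comp_mem {X Y Z : C} {f : X ⟶ Y} (hf : f ∈ rad K X Y) (h : Y ⟶ Z) :
    f ≫ h ∈ rad K X Z := fun g => by
  rw [Category.assoc]
  exact hf (h ≫ g)

theorem exists_right_inverse_of_mem_rad {X : C} {f : X ⟶ X} (hf : f ∈ rad K X X) :
    ∃ z : X ⟶ X, (𝟙 X - f) ≫ z = 𝟙 X := by
  have h1 := hf (𝟙 X)
  rw [← Ideal.jacobson_bot] at h1
  obtain ⟨z, h2⟩ : ∃ z : X ⟶ X, -((f ≫ 𝟙 X) ≫ z) + z - 𝟙 X = 0 := by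
    obtain ⟨z, hz⟩ := (Ideal.mem_jacobson_iff (R := End X)).1 h1 (-1)
    have h3 := (Submodule.mem_bot _).1 hz
    rw [mul_neg, mul_one, neg_mul] at h3
    exact ⟨z, h3⟩
  refine ⟨z, ?_⟩
  rw [Category.comp_id] at h2
  rw [Preadditive.sub_comp, Category.id_comp, ← sub_eq_zero, ← h2]
  abel

/-- A right inverse z of 1 - f equals 1 + fz, which is again 1 minus a radical element. So z has a
right inverse too, and this must be 1 - f. -/
theorem isIso_id_sub_of_mem_rad {X : C} {f : X ⟶ X} (hf : f ∈ rad K X X) : IsIso (𝟙 X - f) := by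
  obtain ⟨z, hz⟩ := exists_right_inverse_of_mem_rad hf
  obtain ⟨y, hy⟩ := exists_right_inverse_of_mem_rad (Submodule.neg_mem _ (rad_comp_mem hf z))
  have hz' : 𝟙 X - -(f ≫ z) = z := by
    rw [← hz, Preadditive.sub_comp, Category.id_comp]
    abel
  rw [hz'] at hy
  have : 𝟙 X - f = y := by
    calc
      𝟙 X - f = (𝟙 X - f) ≫ z ≫ y := by rw [hy, Category.comp_id]
      _ = y := by rw [← Category.assoc, hz, Category.id_comp]
  rw [← this] at hy
  exact ⟨z, hz, hy⟩

theorem isIso_of_id_sub_mem_rad {X : C} {f : X ⟶ X} (hf : 𝟙 X - f ∈ rad K X X) : IsIso f := by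
  have := isIso_id_sub_of_mem_rad hf
  rwa [sub_sub_cancel] at this

theorem id_notMem_rad {X : C} [IsLocalRing (End X)] : 𝟙 X ∉ rad K X X := fun h => by
  obtain ⟨z, hz⟩ := exists_right_inverse_of_mem_rad h
  rw [sub_self, zero_comp] at hz
  exact zero_ne_one (α := End X) hz

/-- A morphism outside the radical, ending in an object with local endomorphism ring, is a
split epimorphism. -/
theorem exists_section_of_notMem_rad {X B : C} [IsLocalRing (End B)] {f : X ⟶ B}
    (hf : f ∉ rad K X B) : ∃ g : B ⟶ X, g ≫ f = 𝟙 B := by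
  by_contra hcon
  refine hf fun g => ?_
  rw [← Ideal.jacobson_bot]
  refine (Ideal.mem_jacobson_iff (R := End X)).2 fun (b : X ⟶ X) => ?_
  -- Locality of `End B` makes one of -(gbf) and 1 + gbf a unit. The first case would produce a
  -- section of `f`.
  obtain ⟨y, hy⟩ : ∃ y : B ⟶ B, (𝟙 B + (g ≫ b) ≫ f) ≫ y = 𝟙 B := by
    have hsum : -((g ≫ b) ≫ f) + (𝟙 B + (g ≫ b) ≫ f) = 𝟙 B := by abel
    rcases IsLocalRing.isUnit_or_isUnit_of_add_one (R := End B) hsum with h | h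
    · obtain ⟨y, hy⟩ := h.exists_right_inv
      refine absurd ⟨-((y : B ⟶ B) ≫ g ≫ b), ?_⟩ hcon
      have hy' : (y : B ⟶ B) ≫ (-((g ≫ b) ≫ f)) = 𝟙 B := hy
      rw [← hy']
      simp only [Preadditive.neg_comp, Preadditive.comp_neg, Category.assoc]
    · obtain ⟨y, hy⟩ := h.exists_left_inv
      exact ⟨y, hy⟩
  -- The usual transfer of inverses: if y inverts 1 + (gb)f, then 1 - f y (gb) inverts 1 + f(gb).
  refine ⟨(𝟙 X - f ≫ y ≫ g ≫ b : X ⟶ X), (Submodule.mem_bot _).2 ?_⟩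
  have e : f ≫ ((𝟙 B + (g ≫ b) ≫ f) ≫ y) ≫ g ≫ b = f ≫ g ≫ b := by
    rw [hy, Category.id_comp]
  simp only [Preadditive.add_comp, Preadditive.comp_add, Category.assoc, Category.id_comp] at e
  change (f ≫ g) ≫ b ≫ (𝟙 X - f ≫ y ≫ g ≫ b) + (𝟙 X - f ≫ y ≫ g ≫ b) - 𝟙 X = 0
  simp only [Preadditive.comp_sub, Category.comp_id, Category.assoc]
  rw [← e]
  abel

theorem idealAct_mono (I : ∀ X Y : C, Submodule K (X ⟶ Y)) (F : FunMod K C)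
    {N N' : ∀ X, Submodule K (F.val X)} (h : ∀ X, N X ≤ N' X) (M : C) :
    idealAct I F N M ≤ idealAct I F N' M :=
  iSup_mono fun X => iSup_mono fun _ => iSup_mono fun _ => Submodule.map_mono (h X)

theorem res_mem_idealAct {I : ∀ X Y : C, Submodule K (X ⟶ Y)} {F : FunMod K C}
    {N : ∀ X, Submodule K (F.val X)} {M X : C} {f : M ⟶ X} (hf : f ∈ I M X) {x : F.val X}
    (hx : x ∈ N X) : F.res f x ∈ idealAct I F N M :=
  Submodule.mem_iSup_of_mem X (Submodule.mem_iSup_of_mem f (Submodule.mem_iSup_of_mem hf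
    ⟨x, hx, rfl⟩))

theorem idealAct_le {I : ∀ X Y : C, Submodule K (X ⟶ Y)} {F : FunMod K C}
    {N : ∀ X, Submodule K (F.val X)} {M : C} {S : Submodule K (F.val M)}
    (h : ∀ X (f : M ⟶ X), f ∈ I M X → ∀ x ∈ N X, F.res f x ∈ S) : idealAct I F N M ≤ S :=
  iSup_le fun X => iSup_le fun f => iSup_le fun hf => by
    rintro _ ⟨x, hx, rfl⟩
    exact h X f hf x hx

theorem map_idealAct (I : ∀ X Y : C, Submodule K (X ⟶ Y)) {F G : FunMod K C} (η : F ⟶ G)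
    (N : ∀ X, Submodule K (F.val X)) (M : C) :
    (idealAct I F N M).map (FunMod.comp η M) =
      idealAct I G (fun X => (N X).map (FunMod.comp η X)) M := by
  apply le_antisymm
  · rw [Submodule.map_le_iff_le_comap]
    refine idealAct_le fun X f hf x hx => ?_
    rw [Submodule.mem_comap, FunMod.comp_res]
    exact res_mem_idealAct hf ⟨x, hx, rfl⟩
  · refine idealAct_le fun X f hf y hy => ?_
    obtain ⟨x, hx, rfl⟩ := hy
    rw [← FunMod.comp_res]
    exact ⟨_, res_mem_idealAct hf hx, rfl⟩

theorem map_radPowSub (k : ℕ) {F G : FunMod K C} (η : F ⟶ G) (X : C) :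
    (radPowSub k F X).map (FunMod.comp η X) =
      idealAct (radPow K k) G (fun X => LinearMap.range (FunMod.comp η X)) X := by
  simp only [radPowSub, map_idealAct, Submodule.map_top]

theorem comp_mem_radPowSub {k : ℕ} {F G : FunMod K C} (η : F ⟶ G) {X : C} {x : F.val X}
    (hx : x ∈ radPowSub k F X) : FunMod.comp η X x ∈ radPowSub k G X := by
  have := Submodule.mem_map_of_mem (f := FunMod.comp η X) hx
  rw [map_radPowSub] at this
  exact idealAct_mono _ _ (fun _ => le_top) _ this

theorem exists_mem_radPowSub (k : ℕ) {F G : FunMod K C} (η : F ⟶ G)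
    (hη : ∀ X, Function.Surjective (FunMod.comp η X)) {X : C} {y : G.val X}
    (hy : y ∈ radPowSub k G X) : ∃ x ∈ radPowSub k F X, FunMod.comp η X x = y := by
  have h := map_radPowSub k η X
  simp only [LinearMap.range_eq_top.2 (hη _)] at h
  rw [radPowSub, ← h] at hy
  exact hy

/-- Contravariance fixes the order: `g ≫ h` acts by F(h) first and then F(g), so `I` is the inner
action. For radical powers this reads rad^(k+1) F = rad^k (rad F), the form in which degrees are
shifted throughout. -/
theorem idealAct_idealMul (I J : ∀ X Y : C, Submodule K (X ⟶ Y)) (F : FunMod K C)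
    (N : ∀ X, Submodule K (F.val X)) (M : C) :
    idealAct (idealMul K I J) F N M = idealAct J F (idealAct I F N) M := by
  apply le_antisymm
  · refine idealAct_le fun X f hf x hx => ?_
    suffices h : idealMul K I J M X ≤
        (idealAct J F (idealAct I F N) M).comap (FunMod.evalRes F x M) from h hf
    refine Submodule.span_le.2 ?_
    rintro _ ⟨A, g, h, hg, hh, rfl⟩
    change F.res (g ≫ h) x ∈ idealAct J F (idealAct I F N) M
    rw [FunMod.res_comp]
    exact res_mem_idealAct hg (res_mem_idealAct hh hx)
  · refine idealAct_le fun A g hg y hy => ?_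
    suffices h : idealAct I F N A ≤ (idealAct (idealMul K I J) F N M).comap (F.res g) from h hy
    refine idealAct_le fun X h hh x hx => ?_
    rw [Submodule.mem_comap, ← FunMod.res_comp]
    exact res_mem_idealAct (show g ≫ h ∈ idealMul K I J M X from
      Submodule.subset_span ⟨A, g, h, hg, hh, rfl⟩) hx

theorem radPowSub_succ (k : ℕ) (F : FunMod K C) (X : C) :
    radPowSub (k + 1) F X = idealAct (radPow K k) F (idealAct (rad K) F (fun _ => ⊤)) X :=
  idealAct_idealMul _ _ _ _ _

theorem radPowSub_zero (F : FunMod K C) (X : C) : radPowSub 0 F X = ⊤ := by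
  refine eq_top_iff.2 fun x _ => ?_
  rw [← FunMod.res_id F X x]
  exact res_mem_idealAct (I := radPow K 0) (N := fun _ => ⊤)
    (show 𝟙 X ∈ radPow K 0 X X from trivial) trivial

theorem radPowSub_one (F : FunMod K C) (X : C) :
    radPowSub 1 F X = idealAct (rad K) F (fun _ => ⊤) X := by
  rw [radPowSub_succ]
  refine le_antisymm (idealAct_le fun Y f _ x hx => res_mem_idealAct_rad F f x hx) fun x hx => ?_
  rw [← FunMod.res_id F X x]
  exact res_mem_idealAct (I := radPow K 0) (show 𝟙 X ∈ radPow K 0 X X from trivial) hx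

theorem elt_mem_rad_iff {X B : C} {f : X ⟶ B} :
    FunMod.elt K X B f ∈ idealAct (rad K) (homFunctor K B) (fun _ => ⊤) X ↔ f ∈ rad K X B := by
  constructor
  · intro h
    have key : idealAct (rad K) (homFunctor K B) (fun _ => ⊤) X ≤
        (rad K X B).map (FunMod.elt K X B).toLinearMap := by
      refine idealAct_le fun Y g hg x _ => ?_
      obtain ⟨h, rfl⟩ := (FunMod.elt K Y B).surjective x
      rw [FunMod.res_elt]
      exact ⟨_, rad_comp_mem hg h, rfl⟩
    obtain ⟨g, hg, hgf⟩ := key h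
    rwa [← (FunMod.elt K X B).injective hgf]
  · intro h
    have := res_mem_idealAct (I := rad K) (F := homFunctor K B) (N := fun _ => ⊤) h
      (x := FunMod.elt K B B (𝟙 B)) trivial
    rwa [FunMod.res_elt, Category.comp_id] at this

end Radical

/-! ### Minimal projective covers over a Krull-Schmidt category -/

section Covers

variable {K : Type w} [Field K] {C : Type u} [Category.{v} C] [Preadditive C] [Linear K C]

/-- An epimorphism `Hom_C(-, B) → F` whose kernel lies in the radical. -/
structure IsMinimalCover {F : FunMod K C} {B : C} (p : homFunctor K B ⟶ F) : Prop where
  surjective : ∀ X, Function.Surjective (FunMod.comp p X)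
  mem_rad : ∀ {X : C} (f : X ⟶ B), FunMod.comp p X (FunMod.elt K X B f) = 0 → f ∈ rad K X B

/-- By Yoneda `e` comes from an endomorphism f of `B`. Then `p` kills 1 - f, so 1 - f is radical and
f is invertible. -/
theorem IsMinimalCover.isIso {F : FunMod K C} {B : C} {p : homFunctor K B ⟶ F}
    (hp : IsMinimalCover p) {e : homFunctor K B ⟶ homFunctor K B} (he : e ≫ p = p) : IsIso e := by
  obtain ⟨f, hf⟩ := (FunMod.elt K B B).surjective (FunMod.comp e B (FunMod.elt K B B (𝟙 B)))
  have hef : e = FunMod.homMap f := FunMod.hom_ext_id (by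
    rw [FunMod.comp_homMap, Category.id_comp, hf])
  have hfr : 𝟙 B - f ∈ rad K B B := hp.mem_rad _ (by
    rw [map_sub, map_sub, hf, ← FunMod.comp_comp, he, sub_self])
  have := isIso_of_id_sub_mem_rad hfr
  refine ⟨FunMod.homMap (inv f), FunMod.hom_ext_id ?_, FunMod.hom_ext_id ?_⟩
  · rw [FunMod.comp_comp, ← hf, FunMod.comp_homMap, IsIso.hom_inv_id, FunMod.comp_id]
  · rw [FunMod.comp_comp, FunMod.comp_homMap, hef, FunMod.comp_homMap, FunMod.comp_id,
      Category.id_comp, IsIso.inv_hom_id]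

theorem IsFinitelyGenerated.of_surjective {F G : FunMod K C} (hF : IsFinitelyGenerated F)
    (e : F ⟶ G) (he : ∀ X, Function.Surjective (FunMod.comp e X)) : IsFinitelyGenerated G := by
  obtain ⟨B, p, hp⟩ := hF
  exact ⟨B, p ≫ e, fun X => (he X).comp (hp X)⟩

theorem isFinitelyGenerated_homFunctor (B : C) : IsFinitelyGenerated (homFunctor K B) :=
  ⟨B, 𝟙 _, fun _ x => ⟨x, rfl⟩⟩

/-- Elements `x i` of `F(Y i)` generating `F`. -/
def Generates (F : FunMod K C) {n : ℕ} (Y : Fin n → C) (x : ∀ i, F.val (Y i)) : Prop :=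
  ∀ X (z : F.val X), ∃ f : ∀ i, X ⟶ Y i, z = ∑ i, F.res (f i) (x i)

variable [HasFiniteBiproducts C]

theorem FunMod.res_biproduct_sum {F : FunMod K C} {n : ℕ} {Y : Fin n → C} (x : ∀ i, F.val (Y i))
    {X : C} (f : X ⟶ ⨁ Y) :
    F.res f (∑ i, F.res (biproduct.π Y i) (x i)) = ∑ i, F.res (f ≫ biproduct.π Y i) (x i) := by
  rw [map_sum]
  exact Finset.sum_congr rfl fun i _ => (FunMod.res_comp F _ _ _).symm

theorem exists_generates (hC : IsKrullSchmidt C) {F : FunMod K C} (hF : IsFinitelyGenerated F) :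
    ∃ (n : ℕ) (Y : Fin n → C) (x : ∀ i, F.val (Y i)), (∀ i, IsLocalRing (End (Y i))) ∧
      Generates F Y x := by
  obtain ⟨B, p, hp⟩ := hF
  obtain ⟨n, Y, hY, ⟨e⟩⟩ := hC B
  refine ⟨n, Y, fun i => FunMod.comp p (Y i) (FunMod.elt K _ _ (biproduct.ι Y i ≫ e.inv)), hY,
    fun X z => ?_⟩
  obtain ⟨y, rfl⟩ := hp X z
  obtain ⟨f, rfl⟩ := (FunMod.elt K X B).surjective y
  refine ⟨fun i => f ≫ e.hom ≫ biproduct.π Y i, ?_⟩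
  simp only [← FunMod.comp_res, FunMod.res_elt]
  rw [← map_sum, ← map_sum]
  congr 2
  have : f = f ≫ e.hom ≫ 𝟙 _ ≫ e.inv := by simp
  conv_lhs => rw [this, ← biproduct.total]
  simp only [Preadditive.comp_sum, Preadditive.sum_comp, Category.assoc]

/-- Take the least number of generators supported on objects with local endomorphism rings. A
relation with a component outside the radical would have that component split, making the
corresponding generator redundant. -/
theorem exists_isMinimalCover (hC : IsKrullSchmidt C) {F : FunMod K C}
    (hF : IsFinitelyGenerated F) :
    ∃ (B : C) (p : homFunctor K B ⟶ F), IsMinimalCover p := by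
  classical
  have hex := exists_generates hC hF
  obtain ⟨Y, x, hY, hgen⟩ := Nat.find_spec hex
  have hmin := fun m => Nat.find_min hex (m := m)
  generalize Nat.find hex = n at Y x hY hgen hmin
  refine ⟨⨁ Y, FunMod.ofElement F (∑ i, F.res (biproduct.π Y i) (x i)), fun X z => ?_,
    fun {X} f hf => ?_⟩
  · obtain ⟨f, rfl⟩ := hgen X z
    refine ⟨FunMod.elt K X _ (biproduct.lift f), ?_⟩
    rw [FunMod.comp_ofElement, FunMod.res_biproduct_sum]
    simp only [biproduct.lift_π]
  · rw [FunMod.comp_ofElement, FunMod.res_biproduct_sum] at hf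
    suffices h : ∀ i, f ≫ biproduct.π Y i ∈ rad K X (Y i) by
      rw [← Category.comp_id f, ← biproduct.total, Preadditive.comp_sum]
      refine Submodule.sum_mem _ fun i _ => ?_
      rw [← Category.assoc]
      exact rad_comp_mem (h i) _
    intro i
    by_contra hi
    have := hY i
    obtain ⟨g, hg⟩ := exists_section_of_notMem_rad hi
    obtain _ | n := n
    · exact i.elim0
    refine hmin n (Nat.lt_succ_self n) ⟨fun j => Y (i.succAbove j), fun j => x (i.succAbove j),
      fun j => hY _, fun Z z => ?_⟩
    obtain ⟨h, rfl⟩ := hgen Z z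
    -- Pulling the relation back along the section `g` gives the i-th generator coefficient 1, so it
    -- can be solved for.
    have hx : x i = - ∑ j, F.res (g ≫ f ≫ biproduct.π Y (i.succAbove j)) (x (i.succAbove j)) := by
      have h0 := congrArg (F.res g) hf
      rw [map_zero, map_sum] at h0
      simp only [← FunMod.res_comp] at h0
      rw [Fin.sum_univ_succAbove _ i, hg, FunMod.res_id] at h0
      exact eq_neg_of_add_eq_zero_left h0
    refine ⟨fun j => h (i.succAbove j) - h i ≫ g ≫ f ≫ biproduct.π Y (i.succAbove j), ?_⟩
    rw [Fin.sum_univ_succAbove _ i, hx, map_neg, map_sum, add_comm, ← sub_eq_add_neg,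
      ← Finset.sum_sub_distrib]
    refine Finset.sum_congr rfl fun j _ => ?_
    rw [← FunMod.res_comp]
    exact (map_sub (FunMod.evalRes F (x (i.succAbove j)) Z) _ _).symm

end Covers

/-! ### Weak Koszulity by coinduction, and its independence of the resolution -/

section Resolutions

variable {K : Type w} [Field K] {C : Type u} [Category.{v} C] [Preadditive C] [Linear K C]

/-- The condition `rad^(i+1) P ∩ Ω = rad^i Ω` for all `i ≥ 1`, for a monomorphism `Ω → P`. -/
def IsGood {Ω P : FunMod K C} (κ : Ω ⟶ P) : Prop :=
  ∀ i, 1 ≤ i → ∀ X, radPowSub (i + 1) P X ⊓ LinearMap.range (FunMod.comp κ X) =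
    (radPowSub i Ω X).map (FunMod.comp κ X)

/-- The condition `rad^k G ∩ F = rad^k F` for all `k`, for a monomorphism `F → G`. -/
def IsRadPure {F G : FunMod K C} (a : F ⟶ G) : Prop :=
  ∀ (k : ℕ) (X : C), radPowSub k G X ⊓ LinearMap.range (FunMod.comp a X) =
    (radPowSub k F X).map (FunMod.comp a X)

theorem IsShortExact.injective {F₁ F₂ F₃ : FunMod K C} {a : F₁ ⟶ F₂} {b : F₂ ⟶ F₃}
    (h : IsShortExact a b) (X : C) : Function.Injective (FunMod.comp a X) := (h X).1

theorem IsShortExact.exact {F₁ F₂ F₃ : FunMod K C} {a : F₁ ⟶ F₂} {b : F₂ ⟶ F₃}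
    (h : IsShortExact a b) (X : C) :
    Function.Exact (FunMod.comp a X) (FunMod.comp b X) := (h X).2.1

theorem IsShortExact.surjective {F₁ F₂ F₃ : FunMod K C} {a : F₁ ⟶ F₂} {b : F₂ ⟶ F₃}
    (h : IsShortExact a b) (X : C) : Function.Surjective (FunMod.comp b X) := (h X).2.2

theorem IsShortExact.comp_eq_zero {F₁ F₂ F₃ : FunMod K C} {a : F₁ ⟶ F₂} {b : F₂ ⟶ F₃}
    (h : IsShortExact a b) {X : C} (x : F₁.val X) :
    FunMod.comp b X (FunMod.comp a X x) = 0 := (h.exact X).apply_apply_eq_zero x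

theorem FunMod.res_mem_ker {F G : FunMod K C} (η : F ⟶ G) {X Y : C} (f : X ⟶ Y) (x : F.val Y)
    (hx : x ∈ LinearMap.ker (FunMod.comp η Y)) : F.res f x ∈ LinearMap.ker (FunMod.comp η X) := by
  rw [LinearMap.mem_ker] at hx ⊢
  rw [FunMod.comp_res, hx, map_zero]

/-- The kernel of a morphism. -/
def FunMod.ker {F G : FunMod K C} (η : F ⟶ G) : FunMod K C :=
  FunMod.sub F (fun X => LinearMap.ker (FunMod.comp η X)) (FunMod.res_mem_ker η)

/-- The inclusion of the kernel of a morphism. -/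
def FunMod.kerι {F G : FunMod K C} (η : F ⟶ G) : FunMod.ker η ⟶ F :=
  FunMod.subι F _ (FunMod.res_mem_ker η)

theorem FunMod.range_kerι {F G : FunMod K C} (η : F ⟶ G) (X : C) :
    LinearMap.range (FunMod.comp (FunMod.kerι η) X) = LinearMap.ker (FunMod.comp η X) := by
  ext x
  constructor
  · rintro ⟨y, rfl⟩
    exact Subtype.prop (p := fun x => x ∈ LinearMap.ker (FunMod.comp η X)) y
  · exact fun hx => ⟨⟨x, hx⟩, rfl⟩

theorem isShortExact_kerι {F G : FunMod K C} (η : F ⟶ G)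
    (h : ∀ X, Function.Surjective (FunMod.comp η X)) : IsShortExact (FunMod.kerι η) η := fun X =>
  ⟨fun _ _ h => Subtype.ext h, LinearMap.exact_iff.2 (FunMod.range_kerι η X).symm, h X⟩

/-- Cutting off the first term of the resolution leaves a resolution of the first syzygy with the
remaining syzygies unchanged. This is the elimination rule matching `isWeaklyKoszul_of_coinduction`.
-/
theorem IsWeaklyKoszul.exists_cover {F : FunMod K C} (hF : IsWeaklyKoszul F) :
    ∃ (P Ω : FunMod K C) (κ : Ω ⟶ P) (ε : P ⟶ F), IsFinitelyGenerated P ∧ Projective P ∧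
      IsShortExact κ ε ∧ IsGood κ ∧ IsWeaklyKoszul Ω := by
  obtain ⟨R, hR⟩ := hF
  have hses := isShortExact_kerι R.ε R.surjective
  have hd0 : ∀ X, LinearMap.ker (FunMod.comp R.ε X) = LinearMap.range (FunMod.comp (R.d 0) X) :=
    fun X => LinearMap.exact_iff.1 (R.exact_zero X)
  obtain ⟨ε', hε'⟩ := FunMod.exists_factor (FunMod.kerι R.ε) hses.injective (R.d 0) fun X x => by
    rw [FunMod.range_kerι, hd0]
    exact ⟨x, rfl⟩
  have hε'' : ∀ X x, FunMod.comp (FunMod.kerι R.ε) X (FunMod.comp ε' X x) =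
      FunMod.comp (R.d 0) X x := fun X x => by
    rw [← hε', FunMod.comp_comp]
  have hker : ∀ X, LinearMap.ker (FunMod.comp ε' X) = LinearMap.ker (FunMod.comp (R.d 0) X) :=
    fun X => by
      ext x
      rw [LinearMap.mem_ker, LinearMap.mem_ker, ← hε'', map_eq_zero_iff _ (hses.injective X)]
  refine ⟨R.P 0, FunMod.ker R.ε, FunMod.kerι R.ε, R.ε, R.fg 0, R.projective 0, hses,
    fun i hi X => ?_, ?_⟩
  · rw [map_radPowSub]
    simp only [FunMod.range_kerι]
    exact hR 0 i hi X
  · let R' : FGProjResolution (FunMod.ker R.ε) :=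
      { P := fun n => R.P (n + 1)
        d := fun n => R.d (n + 1)
        ε := ε'
        fg := fun n => R.fg _
        projective := fun n => R.projective _
        surjective := fun X y => by
          have hy : FunMod.comp (FunMod.kerι R.ε) X y ∈
              LinearMap.range (FunMod.comp (R.d 0) X) := by
            rw [← hd0, ← FunMod.range_kerι]
            exact ⟨y, rfl⟩
          obtain ⟨x, hx⟩ := hy
          exact ⟨x, hses.injective X ((hε'' X x).trans hx)⟩
        exact_zero := fun X => by
          rw [LinearMap.exact_iff, hker]
          exact LinearMap.exact_iff.1 (R.exact_succ 0 X)
        exact_succ := fun n X => R.exact_succ (n + 1) X }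
    have hsyz : ∀ j, R'.syzygy j = R.syzygy (j + 1) := by
      rintro (_ | j)
      · exact funext hker
      · rfl
    refine ⟨R', fun j i hi X => ?_⟩
    rw [hsyz]
    exact hR (j + 1) i hi X

theorem IsWeaklyKoszul.isFinitelyGenerated {F : FunMod K C} (hF : IsWeaklyKoszul F) :
    IsFinitelyGenerated F := by
  obtain ⟨P, Ω, κ, ε, hP, -, h, -⟩ := hF.exists_cover
  exact hP.of_surjective ε h.surjective

theorem IsShortExact.exact_comp {Ω P F Q G : FunMod K C} {κ : Ω ⟶ P} {p : P ⟶ F}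
    (h : IsShortExact κ p) (q : Q ⟶ Ω) (hq : ∀ X, Function.Surjective (FunMod.comp q X))
    (m : F ⟶ G) (hm : ∀ X, Function.Injective (FunMod.comp m X)) (X : C) :
    Function.Exact (FunMod.comp (q ≫ κ) X) (FunMod.comp (p ≫ m) X) := fun x => by
  rw [FunMod.comp_comp, map_eq_zero_iff _ (hm X), h.exact X x]
  constructor
  · rintro ⟨y, rfl⟩
    obtain ⟨z, rfl⟩ := hq X y
    exact ⟨z, rfl⟩
  · rintro ⟨z, rfl⟩
    exact ⟨_, rfl⟩

/-- Weak Koszulity is the largest class closed under passing to kernels of suitable covers. -/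
theorem isWeaklyKoszul_of_coinduction (W : FunMod K C → Prop)
    (h : ∀ F, W F → ∃ (B : C) (Ω : FunMod K C) (κ : Ω ⟶ homFunctor K B) (p : homFunctor K B ⟶ F),
      IsShortExact κ p ∧ IsGood κ ∧ W Ω) {F : FunMod K C} (hF : W F) : IsWeaklyKoszul F := by
  choose B Ω κ p hses hgood hW using h
  -- `G n` is the n-th syzygy with its membership in `W`; splicing the chosen short exact sequences
  -- gives the resolution.
  let G : ℕ → {F // W F} := fun n => Nat.rec ⟨F, hF⟩ (fun _ G => ⟨Ω G.1 G.2, hW G.1 G.2⟩) n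
  let R : FGProjResolution F :=
    { P := fun n => homFunctor K (B (G n).1 (G n).2)
      d := fun n => p (G (n + 1)).1 (G (n + 1)).2 ≫ κ (G n).1 (G n).2
      ε := p (G 0).1 (G 0).2
      fg := fun n => isFinitelyGenerated_homFunctor _
      projective := fun n => inferInstance
      surjective := fun X => (hses (G 0).1 (G 0).2).surjective X
      exact_zero := fun X => by
        have := (hses (G 0).1 (G 0).2).exact_comp (p (G 1).1 (G 1).2)
          (hses (G 1).1 (G 1).2).surjective (𝟙 _) (fun X => Function.injective_id) X
        rwa [Category.comp_id] at this
      exact_succ := fun n X => (hses (G (n + 1)).1 (G (n + 1)).2).exact_comp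
        (p (G (n + 2)).1 (G (n + 2)).2) (hses (G (n + 2)).1 (G (n + 2)).2).surjective
        (κ (G n).1 (G n).2) (hses (G n).1 (G n).2).injective X }
  have hsyz : ∀ j X, R.syzygy j X = LinearMap.range (FunMod.comp (κ (G j).1 (G j).2) X) := by
    rintro (_ | j) X
    · exact LinearMap.exact_iff.1 ((hses (G 0).1 (G 0).2).exact X)
    · rw [← LinearMap.exact_iff.1 ((hses (G (j + 1)).1 (G (j + 1)).2).exact X)]
      ext x
      exact map_eq_zero_iff _ ((hses (G j).1 (G j).2).injective X)
  refine ⟨R, fun j i hi X => ?_⟩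
  have := hgood (G j).1 (G j).2 i hi X
  rw [map_radPowSub] at this
  rw [funext (hsyz j)]
  exact this

theorem exists_lift_of_isShortExact {Ω P F Ω' P' F' : FunMod K C} {κ : Ω ⟶ P} {ε : P ⟶ F}
    {κ' : Ω' ⟶ P'} {ε' : P' ⟶ F'} (h : IsShortExact κ ε) (h' : IsShortExact κ' ε')
    (g : P ⟶ P') (f : F ⟶ F') (hgf : g ≫ ε' = ε ≫ f) : ∃ k : Ω ⟶ Ω', k ≫ κ' = κ ≫ g := by
  refine FunMod.exists_factor κ' h'.injective _ fun X x => ?_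
  have : FunMod.comp ε' X (FunMod.comp (κ ≫ g) X x) = 0 := by
    rw [← FunMod.comp_comp, Category.assoc, hgf, FunMod.comp_comp, FunMod.comp_comp,
      h.comp_eq_zero, map_zero]
  exact (h'.exact X _).1 this

theorem IsGood.of_retract {Ω P Ω' P' : FunMod K C} {κ : Ω ⟶ P} {κ' : Ω' ⟶ P'}
    (h' : IsGood κ') {s : Ω ⟶ Ω'} {r : Ω' ⟶ Ω} {σ : P ⟶ P'} {ρ : P' ⟶ P} (hσρ : σ ≫ ρ = 𝟙 P)
    (hs : s ≫ κ' = κ ≫ σ) (hr : r ≫ κ = κ' ≫ ρ) : IsGood κ := by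
  intro i hi X
  have hs' : ∀ x, FunMod.comp κ' X (FunMod.comp s X x) = FunMod.comp σ X (FunMod.comp κ X x) :=
    fun x => congrArg (fun t => FunMod.comp t X x) hs
  have hr' : ∀ x, FunMod.comp κ X (FunMod.comp r X x) = FunMod.comp ρ X (FunMod.comp κ' X x) :=
    fun x => congrArg (fun t => FunMod.comp t X x) hr
  have hσρ' : ∀ x, FunMod.comp ρ X (FunMod.comp σ X x) = x :=
    fun x => congrArg (fun t => FunMod.comp t X x) hσρ
  apply le_antisymm
  · rintro _ ⟨hx, y, rfl⟩
    have h1 : FunMod.comp κ' X (FunMod.comp s X y) ∈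
        radPowSub (i + 1) P' X ⊓ LinearMap.range (FunMod.comp κ' X) :=
      ⟨by rw [hs']; exact comp_mem_radPowSub σ hx, ⟨_, rfl⟩⟩
    rw [h' i hi X] at h1
    obtain ⟨z, hz, hzy⟩ := h1
    refine ⟨FunMod.comp r X z, comp_mem_radPowSub r hz, ?_⟩
    rw [hr', hzy, hs', hσρ']
  · rintro _ ⟨y, hy, rfl⟩
    refine ⟨?_, y, rfl⟩
    have h1 : FunMod.comp κ' X (FunMod.comp s X y) ∈
        (radPowSub i Ω' X).map (FunMod.comp κ' X) := ⟨_, comp_mem_radPowSub s hy, rfl⟩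
    rw [← h' i hi X] at h1
    rw [← hσρ' (FunMod.comp κ X y), ← hs']
    exact comp_mem_radPowSub ρ h1.1

/-- If `F` is a retract of `H`, then a minimal cover of `F` inherits from a good projective cover
of `H` its goodness, and its kernel is a retract of the kernel of the latter. -/
theorem IsMinimalCover.isGood_of_retract {F H : FunMod K C} {s : F ⟶ H} {r : H ⟶ F}
    (hsr : s ≫ r = 𝟙 F) {P Ω : FunMod K C} [Projective P] {κ : Ω ⟶ P} {ε : P ⟶ H}
    (hε : IsShortExact κ ε) (hκ : IsGood κ) {B : C} {p : homFunctor K B ⟶ F}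
    (hp : IsMinimalCover p) {Ω' : FunMod K C} {κ' : Ω' ⟶ homFunctor K B}
    (hκ' : IsShortExact κ' p) :
    IsGood κ' ∧ ∃ (s' : Ω' ⟶ Ω) (r' : Ω ⟶ Ω'), s' ≫ r' = 𝟙 Ω' := by
  obtain ⟨σ, hσ⟩ := FunMod.exists_lift (p ≫ s) ε hε.surjective
  obtain ⟨ρ, hρ⟩ := FunMod.exists_lift (ε ≫ r) p hp.surjective
  -- The composite of the two lifts lies over the identity of `F`, so minimality makes it
  -- invertible; correcting `ρ` by its inverse gives an honest retraction.
  have he : (σ ≫ ρ) ≫ p = p := by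
    rw [Category.assoc, hρ, ← Category.assoc, hσ, Category.assoc, hsr, Category.comp_id]
  have := hp.isIso he
  have he' : inv (σ ≫ ρ) ≫ p = p := by
    rw [IsIso.inv_comp_eq, he]
  have hσρ : σ ≫ ρ ≫ inv (σ ≫ ρ) = 𝟙 _ := by
    rw [← Category.assoc, IsIso.hom_inv_id]
  obtain ⟨s', hs'⟩ := exists_lift_of_isShortExact hκ' hε σ s hσ
  obtain ⟨r', hr'⟩ := exists_lift_of_isShortExact hε hκ' (ρ ≫ inv (σ ≫ ρ)) r (by
    rw [Category.assoc, he', hρ])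
  refine ⟨hκ.of_retract hσρ hs' hr', s', r', FunMod.hom_ext' fun X x => hκ'.injective X ?_⟩
  have : (s' ≫ r') ≫ κ' = κ' := by
    rw [Category.assoc, hr', ← Category.assoc, hs', Category.assoc, hσρ, Category.comp_id]
  exact congrArg (fun t => FunMod.comp t X x) this

variable [HasFiniteBiproducts C]

/-- The coinductive class is that of all retracts of weakly Koszul functors: the kernel of a minimal
cover is a retract of the syzygy upstairs, so the class reproduces itself. -/
theorem IsWeaklyKoszul.of_retract (hC : IsKrullSchmidt C) {F H : FunMod K C}
    (hH : IsWeaklyKoszul H) {s : F ⟶ H} {r : H ⟶ F} (hsr : s ≫ r = 𝟙 F) : IsWeaklyKoszul F := by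
  refine isWeaklyKoszul_of_coinduction (fun F => ∃ (H : FunMod K C) (s : F ⟶ H) (r : H ⟶ F),
    s ≫ r = 𝟙 F ∧ IsWeaklyKoszul H) ?_ ⟨H, s, r, hsr, hH⟩
  rintro F ⟨H, s, r, hsr, hH⟩
  obtain ⟨B, p, hp⟩ := exists_isMinimalCover hC (hH.isFinitelyGenerated.of_surjective r
    fun X x => ⟨FunMod.comp s X x, congrArg (fun t => FunMod.comp t X x) hsr⟩)
  obtain ⟨P, Ω, κ, ε, -, hP, hε, hκ, hΩ⟩ := hH.exists_cover
  have hses := isShortExact_kerι p hp.surjective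
  obtain ⟨hgood, s', r', hsr'⟩ := hp.isGood_of_retract hsr hε hκ hses
  exact ⟨B, _, _, p, hses, hgood, _, s', r', hsr', hΩ⟩

/-- Apply the comparison of covers to `F` as a retract of itself. This frees later arguments from
the unspecified resolution in the definition. -/
theorem IsWeaklyKoszul.kernel (hC : IsKrullSchmidt C) {F : FunMod K C}
    (hF : IsWeaklyKoszul F) {B : C} {p : homFunctor K B ⟶ F} (hp : IsMinimalCover p)
    {Ω : FunMod K C} {κ : Ω ⟶ homFunctor K B} (hκ : IsShortExact κ p) :
    IsGood κ ∧ IsWeaklyKoszul Ω := by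
  obtain ⟨P, Ω', κ', ε, -, hP, hε, hκ', hΩ'⟩ := hF.exists_cover
  obtain ⟨hgood, s', r', hsr'⟩ := hp.isGood_of_retract (Category.comp_id (𝟙 F)) hε hκ' hκ
  exact ⟨hgood, hΩ'.of_retract hC hsr'⟩

end Resolutions

/-! ### The horseshoe diagram and closure under right and middle terms -/

section Horseshoe

variable {K : Type w} [Field K] {C : Type u} [Category.{v} C] [Preadditive C] [Linear K C]

theorem IsGood.mem {Ω P : FunMod K C} {κ : Ω ⟶ P} (h : IsGood κ)
    (hκ : ∀ X, Function.Injective (FunMod.comp κ X)) {i : ℕ} (hi : 1 ≤ i) {X : C} {y : Ω.val X}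
    (hy : FunMod.comp κ X y ∈ radPowSub (i + 1) P X) : y ∈ radPowSub i Ω X := by
  have h1 : FunMod.comp κ X y ∈ (radPowSub i Ω X).map (FunMod.comp κ X) := by
    rw [← h i hi X]
    exact ⟨hy, y, rfl⟩
  obtain ⟨z, hz, hzy⟩ := h1
  rwa [← hκ X hzy]

theorem IsRadPure.mem {F G : FunMod K C} {a : F ⟶ G} (h : IsRadPure a)
    (ha : ∀ X, Function.Injective (FunMod.comp a X)) {k : ℕ} {X : C} {y : F.val X}
    (hy : FunMod.comp a X y ∈ radPowSub k G X) : y ∈ radPowSub k F X := by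
  have h1 : FunMod.comp a X y ∈ (radPowSub k F X).map (FunMod.comp a X) := by
    rw [← h k X]
    exact ⟨hy, y, rfl⟩
  obtain ⟨z, hz, hzy⟩ := h1
  rwa [← ha X hzy]

theorem isRadPure_of_mem {F G : FunMod K C} {a : F ⟶ G}
    (h : ∀ k, 1 ≤ k → ∀ X (y : F.val X), FunMod.comp a X y ∈ radPowSub k G X →
      y ∈ radPowSub k F X) : IsRadPure a := by
  intro k X
  apply le_antisymm
  · rintro _ ⟨hx, y, rfl⟩
    refine ⟨y, ?_, rfl⟩
    obtain _ | k := k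
    · rw [SetLike.mem_coe, radPowSub_zero]
      trivial
    · exact h _ (Nat.le_add_left _ _) X y hx
  · rintro _ ⟨y, hy, rfl⟩
    exact ⟨comp_mem_radPowSub a hy, y, rfl⟩

theorem isRadPure_of_retract {F G : FunMod K C} {a : F ⟶ G} {r : G ⟶ F} (h : a ≫ r = 𝟙 F) :
    IsRadPure a := isRadPure_of_mem fun k _ X y hy => by
  have := comp_mem_radPowSub r hy
  rwa [← FunMod.comp_comp, h, FunMod.comp_id] at this

theorem mem_radPowSub_succ_of_range_le {Ω P : FunMod K C} {κ : Ω ⟶ P}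
    (h : ∀ X x, FunMod.comp κ X x ∈ idealAct (rad K) P (fun _ => ⊤) X) {k : ℕ} {X : C}
    {y : Ω.val X} (hy : y ∈ radPowSub k Ω X) : FunMod.comp κ X y ∈ radPowSub (k + 1) P X := by
  have h1 := Submodule.mem_map_of_mem (f := FunMod.comp κ X) hy
  rw [map_radPowSub] at h1
  rw [radPowSub_succ]
  refine idealAct_mono _ _ (fun Y => ?_) _ h1
  rintro _ ⟨x, rfl⟩
  exact h Y x

/-- Once Ω ⊆ rad P, the inclusion rad^i Ω ⊆ rad^i (rad P) = rad^(i+1) P is automatic, so only the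
other one has to be checked. -/
theorem isGood_of_mem {Ω P : FunMod K C} {κ : Ω ⟶ P}
    (hκ : ∀ X x, FunMod.comp κ X x ∈ idealAct (rad K) P (fun _ => ⊤) X)
    (h : ∀ i, 1 ≤ i → ∀ X (y : Ω.val X), FunMod.comp κ X y ∈ radPowSub (i + 1) P X →
      y ∈ radPowSub i Ω X) : IsGood κ := by
  intro i hi X
  apply le_antisymm
  · rintro _ ⟨hx, y, rfl⟩
    exact ⟨y, h i hi X y hx, rfl⟩
  · rintro _ ⟨y, hy, rfl⟩
    exact ⟨mem_radPowSub_succ_of_range_le hκ hy, y, rfl⟩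

theorem IsMinimalCover.kernel_mem {F : FunMod K C} {B : C} {p : homFunctor K B ⟶ F}
    (hp : IsMinimalCover p) {Ω : FunMod K C} {κ : Ω ⟶ homFunctor K B} (hκ : IsShortExact κ p)
    (X : C) (x : Ω.val X) :
    FunMod.comp κ X x ∈ idealAct (rad K) (homFunctor K B) (fun _ => ⊤) X := by
  obtain ⟨f, hf⟩ := (FunMod.elt K X B).surjective (FunMod.comp κ X x)
  rw [← hf, elt_mem_rad_iff]
  exact hp.mem_rad f (by rw [hf, hκ.comp_eq_zero])

/-- A commutative diagram with exact columns `Ωᵢ → Pᵢ → Fᵢ` and exact rows `P₁ → P₂ → P₃` and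
`F₁ → F₂ → F₃`, the former being split. -/
structure IsHorseshoe {F₁ F₂ F₃ P₁ P₂ P₃ Ω₁ Ω₂ Ω₃ : FunMod K C} (a : F₁ ⟶ F₂) (b : F₂ ⟶ F₃)
    (i : P₁ ⟶ P₂) (ρ : P₂ ⟶ P₁) (q : P₂ ⟶ P₃) (σ : P₃ ⟶ P₂) (α : Ω₁ ⟶ Ω₂) (β : Ω₂ ⟶ Ω₃)
    (κ₁ : Ω₁ ⟶ P₁) (κ₂ : Ω₂ ⟶ P₂) (κ₃ : Ω₃ ⟶ P₃) (p₁ : P₁ ⟶ F₁) (p₂ : P₂ ⟶ F₂)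
    (p₃ : P₃ ⟶ F₃) : Prop where
  ab : IsShortExact a b
  iq : IsShortExact i q
  retraction : ∀ X x, FunMod.comp ρ X (FunMod.comp i X x) = x
  splitting : ∀ X x, FunMod.comp q X (FunMod.comp σ X x) = x
  col₁ : IsShortExact κ₁ p₁
  col₂ : IsShortExact κ₂ p₂
  col₃ : IsShortExact κ₃ p₃
  α_κ : ∀ X x, FunMod.comp κ₂ X (FunMod.comp α X x) = FunMod.comp i X (FunMod.comp κ₁ X x)
  β_κ : ∀ X x, FunMod.comp κ₃ X (FunMod.comp β X x) = FunMod.comp q X (FunMod.comp κ₂ X x)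
  p_a : ∀ X x, FunMod.comp p₂ X (FunMod.comp i X x) = FunMod.comp a X (FunMod.comp p₁ X x)
  p_b : ∀ X x, FunMod.comp p₃ X (FunMod.comp q X x) = FunMod.comp b X (FunMod.comp p₂ X x)

namespace IsHorseshoe

variable {F₁ F₂ F₃ P₁ P₂ P₃ Ω₁ Ω₂ Ω₃ : FunMod K C} {a : F₁ ⟶ F₂} {b : F₂ ⟶ F₃}
  {i : P₁ ⟶ P₂} {ρ : P₂ ⟶ P₁} {q : P₂ ⟶ P₃} {σ : P₃ ⟶ P₂} {α : Ω₁ ⟶ Ω₂} {β : Ω₂ ⟶ Ω₃}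
  {κ₁ : Ω₁ ⟶ P₁} {κ₂ : Ω₂ ⟶ P₂} {κ₃ : Ω₃ ⟶ P₃} {p₁ : P₁ ⟶ F₁} {p₂ : P₂ ⟶ F₂}
  {p₃ : P₃ ⟶ F₃}

theorem isShortExact (h : IsHorseshoe a b i ρ q σ α β κ₁ κ₂ κ₃ p₁ p₂ p₃) :
    IsShortExact α β := fun X => by
  refine ⟨fun x y hxy => ?_, fun y => ⟨fun hy => ?_, ?_⟩, fun z => ?_⟩
  · apply h.col₁.injective X
    apply h.iq.injective X
    rw [← h.α_κ, ← h.α_κ, hxy]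
  · obtain ⟨w, hw⟩ := (h.iq.exact X (FunMod.comp κ₂ X y)).1 (by rw [← h.β_κ, hy, map_zero])
    obtain ⟨v, rfl⟩ := (h.col₁.exact X w).1 (h.ab.injective X (by
      rw [← h.p_a, hw, h.col₂.comp_eq_zero, map_zero]))
    exact ⟨v, h.col₂.injective X (by rw [h.α_κ, hw])⟩
  · rintro ⟨x, rfl⟩
    apply h.col₃.injective X
    rw [h.β_κ, h.α_κ, h.iq.comp_eq_zero, map_zero]
  · have h1 : FunMod.comp b X (FunMod.comp p₂ X (FunMod.comp σ X (FunMod.comp κ₃ X z))) = 0 := by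
      rw [← h.p_b, h.splitting, h.col₃.comp_eq_zero]
    obtain ⟨f, hf⟩ := (h.ab.exact X _).1 h1
    obtain ⟨w, rfl⟩ := h.col₁.surjective X f
    have h2 : FunMod.comp p₂ X (FunMod.comp σ X (FunMod.comp κ₃ X z) - FunMod.comp i X w) = 0 := by
      rw [map_sub, h.p_a, hf, sub_self]
    obtain ⟨y, hy⟩ := (h.col₂.exact X _).1 h2
    refine ⟨y, h.col₃.injective X ?_⟩
    rw [h.β_κ, hy, map_sub, h.splitting, h.iq.comp_eq_zero, sub_zero]

/-- An element of Ω₁ lying in rad^k Ω₂ lies in rad^(k+1) P₂. The retraction `ρ` returns it to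
rad^(k+1) P₁, and goodness of `κ₁` lowers the degree again. -/
theorem isRadPure (h : IsHorseshoe a b i ρ q σ α β κ₁ κ₂ κ₃ p₁ p₂ p₃) (h₁ : IsGood κ₁)
    (h₂ : ∀ X x, FunMod.comp κ₂ X x ∈ idealAct (rad K) P₂ (fun _ => ⊤) X) : IsRadPure α :=
  isRadPure_of_mem fun k hk X y hy => by
    have h3 := mem_radPowSub_succ_of_range_le h₂ hy
    rw [h.α_κ] at h3
    have h4 := comp_mem_radPowSub ρ h3
    rw [h.retraction] at h4
    exact h₁.mem h.col₁.injective hk h4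

/-- Lift an element of Ω₃ ∩ rad^(k+1) P₃ along `σ`. Its image in F₂ lies in F₁ ∩ rad^(k+1) F₂ =
rad^(k+1) F₁, so subtracting an element of rad^(k+1) P₁ moves the lift into Ω₂ without losing
radical degree. Goodness of `κ₂` then applies. -/
theorem isGood_right (h : IsHorseshoe a b i ρ q σ α β κ₁ κ₂ κ₃ p₁ p₂ p₃) (ha : IsRadPure a)
    (h₂ : IsGood κ₂)
    (h₃ : ∀ X x, FunMod.comp κ₃ X x ∈ idealAct (rad K) P₃ (fun _ => ⊤) X) : IsGood κ₃ :=
  isGood_of_mem h₃ fun k hk X z hz => by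
    have hσ := comp_mem_radPowSub σ hz
    have h1 : FunMod.comp b X (FunMod.comp p₂ X (FunMod.comp σ X (FunMod.comp κ₃ X z))) = 0 := by
      rw [← h.p_b, h.splitting, h.col₃.comp_eq_zero]
    obtain ⟨f, hf⟩ := (h.ab.exact X _).1 h1
    have hf' : f ∈ radPowSub (k + 1) F₁ X := ha.mem h.ab.injective (by
      rw [hf]
      exact comp_mem_radPowSub p₂ hσ)
    obtain ⟨w, hw, rfl⟩ := exists_mem_radPowSub _ p₁ h.col₁.surjective hf'
    have h2 : FunMod.comp p₂ X (FunMod.comp σ X (FunMod.comp κ₃ X z) - FunMod.comp i X w) = 0 := by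
      rw [map_sub, h.p_a, hf, sub_self]
    obtain ⟨y, hy⟩ := (h.col₂.exact X _).1 h2
    have hy' : y ∈ radPowSub k Ω₂ X := h₂.mem h.col₂.injective hk (by
      rw [hy]
      exact Submodule.sub_mem _ hσ (comp_mem_radPowSub i hw))
    have hz' : FunMod.comp β X y = z := h.col₃.injective X (by
      rw [h.β_κ, hy, map_sub, h.splitting, h.iq.comp_eq_zero, sub_zero])
    rw [← hz']
    exact comp_mem_radPowSub β hy'

/-- Goodness of `κ₃` puts the image in Ω₃ into rad^k. Subtracting a lift from rad^k Ω₂ leaves an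
element of Ω₁, handled by `ρ` and goodness of `κ₁`. -/
theorem isGood_middle (h : IsHorseshoe a b i ρ q σ α β κ₁ κ₂ κ₃ p₁ p₂ p₃) (h₁ : IsGood κ₁)
    (h₃ : IsGood κ₃)
    (h₂ : ∀ X x, FunMod.comp κ₂ X x ∈ idealAct (rad K) P₂ (fun _ => ⊤) X) : IsGood κ₂ :=
  isGood_of_mem h₂ fun k hk X y hy => by
    have h4 : FunMod.comp β X y ∈ radPowSub k Ω₃ X := h₃.mem h.col₃.injective hk (by
      rw [h.β_κ]
      exact comp_mem_radPowSub q hy)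
    obtain ⟨y', hy', hyy⟩ := exists_mem_radPowSub k β h.isShortExact.surjective h4
    obtain ⟨v, hv⟩ := (h.isShortExact.exact X (y - y')).1 (by rw [map_sub, hyy, sub_self])
    have h5 : FunMod.comp i X (FunMod.comp κ₁ X v) ∈ radPowSub (k + 1) P₂ X := by
      rw [← h.α_κ, hv, map_sub]
      exact Submodule.sub_mem _ hy (mem_radPowSub_succ_of_range_le h₂ hy')
    have h6 := comp_mem_radPowSub ρ h5
    rw [h.retraction] at h6
    rw [← sub_add_cancel y y', ← hv]
    exact Submodule.add_mem _ (comp_mem_radPowSub α (h₁.mem h.col₁.injective hk h6)) hy'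

end IsHorseshoe

theorem FunMod.comp_add {F G : FunMod K C} (η θ : F ⟶ G) (X : C) (x : F.val X) :
    comp (η + θ) X x = comp η X x + comp θ X x := rfl

theorem FunMod.homMap_id (B : C) : homMap (K := K) (𝟙 B) = 𝟙 _ :=
  hom_ext_id (by rw [comp_homMap, comp_id, Category.comp_id])

theorem FunMod.homMap_comp {A B D : C} (f : A ⟶ B) (g : B ⟶ D) :
    homMap (K := K) (f ≫ g) = homMap f ≫ homMap g :=
  hom_ext_id (by simp only [comp_homMap, comp_comp, Category.assoc])

theorem FunMod.homMap_add {A B : C} (f g : A ⟶ B) :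
    homMap (K := K) (f + g) = homMap f + homMap g :=
  hom_ext_id (by simp only [comp_homMap, comp_add, Preadditive.comp_add, map_add])

theorem FunMod.homMap_zero (A B : C) : homMap (K := K) (0 : A ⟶ B) = 0 :=
  hom_ext_id (by simp only [comp_homMap, comp_zero, Limits.comp_zero, map_zero])

theorem isShortExact_of_split {F₁ F₂ F₃ : FunMod K C} {i : F₁ ⟶ F₂} {ρ : F₂ ⟶ F₁} {q : F₂ ⟶ F₃}
    {σ : F₃ ⟶ F₂} (hi : i ≫ ρ = 𝟙 _) (hq : σ ≫ q = 𝟙 _) (hiq : i ≫ q = 0)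
    (hsum : ρ ≫ i + q ≫ σ = 𝟙 _) : IsShortExact i q := fun X => by
  refine ⟨Function.LeftInverse.injective (g := FunMod.comp ρ X)
    fun x => congrArg (fun t => FunMod.comp t X x) hi, fun y => ⟨fun hy => ?_, ?_⟩,
    fun z => ⟨_, congrArg (fun t => FunMod.comp t X z) hq⟩⟩
  · refine ⟨FunMod.comp ρ X y, ?_⟩
    have := congrArg (fun t => FunMod.comp t X y) hsum
    simpa only [FunMod.comp_add, FunMod.comp_comp, FunMod.comp_id, hy, map_zero, add_zero]
      using this
  · rintro ⟨x, rfl⟩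
    exact congrArg (fun t => FunMod.comp t X x) hiq

/-- Minimality is where purity enters, in degree one. For a kernel element the B₃-component is
radical by minimality of `p₃`, so the B₁-component maps into F₁ ∩ rad F₂ = rad F₁. It therefore
differs from a radical morphism by an element of the kernel of `p₁`, itself radical. -/
theorem exists_isMinimalCover_middle [HasBinaryBiproducts C] {F₁ F₂ F₃ : FunMod K C} {a : F₁ ⟶ F₂} {b : F₂ ⟶ F₃}
    (hab : IsShortExact a b) (ha : IsRadPure a) {B₁ B₃ : C} {p₁ : homFunctor K B₁ ⟶ F₁}
    {p₃ : homFunctor K B₃ ⟶ F₃} (h₁ : IsMinimalCover p₁) (h₃ : IsMinimalCover p₃) :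
    ∃ p₂ : homFunctor K (B₁ ⊞ B₃) ⟶ F₂, IsMinimalCover p₂ ∧
      FunMod.homMap biprod.inl ≫ p₂ = p₁ ≫ a ∧ FunMod.homMap biprod.snd ≫ p₃ = p₂ ≫ b := by
  obtain ⟨p, hp⟩ := FunMod.exists_lift p₃ b hab.surjective
  have hpb : ∀ X x, FunMod.comp b X (FunMod.comp p X x) = FunMod.comp p₃ X x :=
    fun X x => congrArg (fun t => FunMod.comp t X x) hp
  have hp₂ : ∀ {X} (f : X ⟶ B₁ ⊞ B₃),
      FunMod.comp (FunMod.homMap biprod.fst ≫ p₁ ≫ a + FunMod.homMap biprod.snd ≫ p) X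
        (FunMod.elt K X _ f) =
      FunMod.comp a X (FunMod.comp p₁ X (FunMod.elt K X _ (f ≫ biprod.fst))) +
        FunMod.comp p X (FunMod.elt K X _ (f ≫ biprod.snd)) := fun f => rfl
  refine ⟨FunMod.homMap biprod.fst ≫ p₁ ≫ a + FunMod.homMap biprod.snd ≫ p,
    ⟨fun X z => ?_, fun {X} f hf => ?_⟩, FunMod.hom_ext_id ?_, FunMod.hom_ext_id ?_⟩
  · obtain ⟨y, hy⟩ := h₃.surjective X (FunMod.comp b X z)
    obtain ⟨g, rfl⟩ := (FunMod.elt K X B₃).surjective y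
    obtain ⟨x, hx⟩ := (hab.exact X (z - FunMod.comp p X (FunMod.elt K X _ g))).1 (by
      rw [map_sub, hpb, hy, sub_self])
    obtain ⟨y, rfl⟩ := h₁.surjective X x
    obtain ⟨f, rfl⟩ := (FunMod.elt K X B₁).surjective y
    refine ⟨FunMod.elt K X _ (biprod.lift f g), ?_⟩
    rw [hp₂, biprod.lift_fst, biprod.lift_snd, hx, sub_add_cancel]
  · rw [hp₂] at hf
    have hsnd : f ≫ biprod.snd ∈ rad K X B₃ := h₃.mem_rad _ (by
      have := congrArg (FunMod.comp b X) hf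
      rwa [map_add, hab.comp_eq_zero, zero_add, hpb, map_zero] at this)
    have hps : FunMod.comp p X (FunMod.elt K X _ (f ≫ biprod.snd)) ∈ radPowSub 1 F₂ X :=
      comp_mem_radPowSub p (by rwa [radPowSub_one, elt_mem_rad_iff])
    have hpf : FunMod.comp p₁ X (FunMod.elt K X _ (f ≫ biprod.fst)) ∈ radPowSub 1 F₁ X :=
      ha.mem hab.injective (by
        rw [eq_neg_of_add_eq_zero_left hf]
        exact Submodule.neg_mem _ hps)
    obtain ⟨y, hy, hyf⟩ := exists_mem_radPowSub 1 p₁ h₁.surjective hpf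
    obtain ⟨h, rfl⟩ := (FunMod.elt K X B₁).surjective y
    rw [radPowSub_one, elt_mem_rad_iff] at hy
    have hfst : f ≫ biprod.fst ∈ rad K X B₁ := by
      rw [← sub_add_cancel (f ≫ biprod.fst) h]
      exact Submodule.add_mem _ (h₁.mem_rad _ (by rw [map_sub, map_sub, hyf, sub_self])) hy
    rw [← Category.comp_id f, ← biprod.total, Preadditive.comp_add, ← Category.assoc,
      ← Category.assoc]
    exact Submodule.add_mem _ (rad_comp_mem hfst _) (rad_comp_mem hsnd _)
  · rw [FunMod.comp_comp, FunMod.comp_homMap, hp₂]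
    simp
  · rw [FunMod.comp_comp, FunMod.comp_comp, hp₂, map_add, hab.comp_eq_zero, zero_add, hpb]
    rfl

theorem exists_isHorseshoe [HasBinaryBiproducts C] {F₁ F₂ F₃ : FunMod K C} {a : F₁ ⟶ F₂} {b : F₂ ⟶ F₃}
    (hab : IsShortExact a b) (ha : IsRadPure a) {B₁ B₃ : C} {p₁ : homFunctor K B₁ ⟶ F₁}
    {p₃ : homFunctor K B₃ ⟶ F₃} (h₁ : IsMinimalCover p₁) (h₃ : IsMinimalCover p₃) :
    ∃ (p₂ : homFunctor K (B₁ ⊞ B₃) ⟶ F₂) (i : homFunctor K B₁ ⟶ homFunctor K (B₁ ⊞ B₃))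
      (ρ : homFunctor K (B₁ ⊞ B₃) ⟶ homFunctor K B₁)
      (q : homFunctor K (B₁ ⊞ B₃) ⟶ homFunctor K B₃)
      (σ : homFunctor K B₃ ⟶ homFunctor K (B₁ ⊞ B₃))
      (α : FunMod.ker p₁ ⟶ FunMod.ker p₂) (β : FunMod.ker p₂ ⟶ FunMod.ker p₃),
      IsMinimalCover p₂ ∧ IsHorseshoe a b i ρ q σ α β (FunMod.kerι p₁) (FunMod.kerι p₂)
        (FunMod.kerι p₃) p₁ p₂ p₃ := by
  obtain ⟨p₂, h₂, hi, hq⟩ := exists_isMinimalCover_middle hab ha h₁ h₃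
  have hs₁ := isShortExact_kerι p₁ h₁.surjective
  have hs₂ := isShortExact_kerι p₂ h₂.surjective
  have hs₃ := isShortExact_kerι p₃ h₃.surjective
  obtain ⟨α, hα⟩ := exists_lift_of_isShortExact hs₁ hs₂ _ _ hi
  obtain ⟨β, hβ⟩ := exists_lift_of_isShortExact hs₂ hs₃ _ _ hq
  have hr : FunMod.homMap (K := K) (biprod.inl : B₁ ⟶ B₁ ⊞ B₃) ≫ FunMod.homMap biprod.fst =
      𝟙 _ := by
    rw [← FunMod.homMap_comp, biprod.inl_fst, FunMod.homMap_id]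
  have hs : FunMod.homMap (K := K) (biprod.inr : B₃ ⟶ B₁ ⊞ B₃) ≫ FunMod.homMap biprod.snd =
      𝟙 _ := by
    rw [← FunMod.homMap_comp, biprod.inr_snd, FunMod.homMap_id]
  have hiq : IsShortExact (FunMod.homMap (K := K) (biprod.inl : B₁ ⟶ B₁ ⊞ B₃))
      (FunMod.homMap biprod.snd) := by
    refine isShortExact_of_split hr hs ?_ ?_
    · rw [← FunMod.homMap_comp, biprod.inl_snd, FunMod.homMap_zero]
    · rw [← FunMod.homMap_comp, ← FunMod.homMap_comp, ← FunMod.homMap_add, biprod.total,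
        FunMod.homMap_id]
  exact ⟨p₂, _, FunMod.homMap biprod.fst, _, FunMod.homMap biprod.inr, α, β, h₂,
    { ab := hab
      iq := hiq
      retraction := fun X x => congrArg (fun t => FunMod.comp t X x) hr
      splitting := fun X x => congrArg (fun t => FunMod.comp t X x) hs
      col₁ := hs₁
      col₂ := hs₂
      col₃ := hs₃
      α_κ := fun X x => congrArg (fun t => FunMod.comp t X x) hα
      β_κ := fun X x => congrArg (fun t => FunMod.comp t X x) hβ
      p_a := fun X x => congrArg (fun t => FunMod.comp t X x) hi
      p_b := fun X x => congrArg (fun t => FunMod.comp t X x) hq }⟩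

variable [HasFiniteBiproducts C]

/-- Coinduction on the cokernels of rad-pure monomorphisms between weakly Koszul functors; the
kernels in the horseshoe form another such sequence. -/
theorem IsWeaklyKoszul.right (hC : IsKrullSchmidt C) {F₁ F₂ F₃ : FunMod K C} {a : F₁ ⟶ F₂}
    {b : F₂ ⟶ F₃} (hab : IsShortExact a b) (ha : IsRadPure a) (h₁ : IsWeaklyKoszul F₁)
    (h₂ : IsWeaklyKoszul F₂) : IsWeaklyKoszul F₃ := by
  have := hasBinaryBiproducts_of_finite_biproducts C
  refine isWeaklyKoszul_of_coinduction (fun F₃ => ∃ (F₁ F₂ : FunMod K C) (a : F₁ ⟶ F₂)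
    (b : F₂ ⟶ F₃), IsShortExact a b ∧ IsRadPure a ∧ IsWeaklyKoszul F₁ ∧ IsWeaklyKoszul F₂) ?_
    ⟨F₁, F₂, a, b, hab, ha, h₁, h₂⟩
  rintro F₃ ⟨F₁, F₂, a, b, hab, ha, h₁, h₂⟩
  obtain ⟨B₁, p₁, hp₁⟩ := exists_isMinimalCover hC h₁.isFinitelyGenerated
  obtain ⟨B₃, p₃, hp₃⟩ := exists_isMinimalCover hC
    (h₂.isFinitelyGenerated.of_surjective b hab.surjective)
  obtain ⟨p₂, i, ρ, q, σ, α, β, hp₂, H⟩ := exists_isHorseshoe hab ha hp₁ hp₃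
  obtain ⟨hg₁, hw₁⟩ := h₁.kernel hC hp₁ H.col₁
  obtain ⟨hg₂, hw₂⟩ := h₂.kernel hC hp₂ H.col₂
  exact ⟨B₃, _, _, p₃, H.col₃, H.isGood_right ha hg₂ (hp₃.kernel_mem H.col₃), _, _, α, β,
    H.isShortExact, H.isRadPure hg₁ (hp₂.kernel_mem H.col₂), hw₁, hw₂⟩

theorem IsWeaklyKoszul.middle (hC : IsKrullSchmidt C) {F₁ F₂ F₃ : FunMod K C} {a : F₁ ⟶ F₂}
    {b : F₂ ⟶ F₃} (hab : IsShortExact a b) (ha : IsRadPure a) (h₁ : IsWeaklyKoszul F₁)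
    (h₃ : IsWeaklyKoszul F₃) : IsWeaklyKoszul F₂ := by
  have := hasBinaryBiproducts_of_finite_biproducts C
  refine isWeaklyKoszul_of_coinduction (fun F₂ => ∃ (F₁ F₃ : FunMod K C) (a : F₁ ⟶ F₂)
    (b : F₂ ⟶ F₃), IsShortExact a b ∧ IsRadPure a ∧ IsWeaklyKoszul F₁ ∧ IsWeaklyKoszul F₃) ?_
    ⟨F₁, F₃, a, b, hab, ha, h₁, h₃⟩
  rintro F₂ ⟨F₁, F₃, a, b, hab, ha, h₁, h₃⟩
  obtain ⟨B₁, p₁, hp₁⟩ := exists_isMinimalCover hC h₁.isFinitelyGenerated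
  obtain ⟨B₃, p₃, hp₃⟩ := exists_isMinimalCover hC h₃.isFinitelyGenerated
  obtain ⟨p₂, i, ρ, q, σ, α, β, hp₂, H⟩ := exists_isHorseshoe hab ha hp₁ hp₃
  obtain ⟨hg₁, hw₁⟩ := h₁.kernel hC hp₁ H.col₁
  obtain ⟨hg₃, hw₃⟩ := h₃.kernel hC hp₃ H.col₃
  have hm := hp₂.kernel_mem H.col₂
  exact ⟨_, _, _, p₂, H.col₂, H.isGood_middle hg₁ hg₃ hm, _, _, α, β,
    H.isShortExact, H.isRadPure hg₁ hm, hw₁, hw₃⟩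

end Horseshoe

/-! ### The radical of a weakly Koszul functor -/

section RadicalFunctor

variable {K : Type w} [Field K] {C : Type u} [Category.{v} C] [Preadditive C] [Linear K C]

/-- The inclusion `rad F → F`. -/
def radι (F : FunMod K C) : radFunctor F ⟶ F :=
  FunMod.mkHom (fun X => (idealAct (rad K) F (fun _ => ⊤) X).subtype) (fun _ _ => rfl)

theorem radι_injective (F : FunMod K C) (X : C) : Function.Injective (FunMod.comp (radι F) X) :=
  fun _ _ h => Subtype.ext h

theorem range_radι (F : FunMod K C) (X : C) :
    LinearMap.range (FunMod.comp (radι F) X) = idealAct (rad K) F (fun _ => ⊤) X := by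
  ext x
  constructor
  · rintro ⟨y, rfl⟩
    exact Subtype.prop (p := fun x => x ∈ idealAct (rad K) F (fun _ => ⊤) X) y
  · exact fun hx => ⟨⟨x, hx⟩, rfl⟩

theorem radι_mem (F : FunMod K C) (X : C) (x : (radFunctor F).val X) :
    FunMod.comp (radι F) X x ∈ idealAct (rad K) F (fun _ => ⊤) X := by
  rw [← range_radι]
  exact ⟨x, rfl⟩

theorem radι_mem_radPowSub_iff {F : FunMod K C} {k : ℕ} {X : C} {x : (radFunctor F).val X} :
    FunMod.comp (radι F) X x ∈ radPowSub (k + 1) F X ↔ x ∈ radPowSub k (radFunctor F) X := by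
  have h := map_radPowSub k (radι F) X
  simp only [range_radι] at h
  rw [radPowSub_succ, ← h]
  constructor
  · rintro ⟨y, hy, hyx⟩
    rwa [← radι_injective F X hyx]
  · exact fun hx => ⟨x, hx, rfl⟩

theorem radι_cancel {F G : FunMod K C} {f g : G ⟶ radFunctor F} (h : f ≫ radι F = g ≫ radι F) :
    f = g :=
  FunMod.hom_ext' fun X x => radι_injective F X (congrArg (fun t => FunMod.comp t X x) h)

theorem exists_radMap {F G : FunMod K C} (η : F ⟶ G) :
    ∃ θ : radFunctor F ⟶ radFunctor G, θ ≫ radι G = radι F ≫ η := by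
  refine FunMod.exists_factor _ (radι_injective G) _ fun X x => ?_
  rw [range_radι, ← radPowSub_one]
  refine comp_mem_radPowSub η ?_
  rw [radPowSub_one]
  exact radι_mem F X x

theorem isWeaklyKoszul_of_subsingleton [HasFiniteBiproducts C] {F : FunMod K C}
    (hF : ∀ X, Subsingleton (F.val X)) : IsWeaklyKoszul F := by
  refine isWeaklyKoszul_of_coinduction (fun F => ∀ X, Subsingleton (F.val X)) ?_ hF
  intro F hF
  let Y : Fin 0 → C := fun j => j.elim0
  have hP : ∀ X, Subsingleton ((homFunctor K (⨁ Y)).val X) := fun X =>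
    ⟨fun f g => biproduct.hom_ext (f := Y) f g fun j => j.elim0⟩
  exact ⟨⨁ Y, F, 0, 0, fun X => ⟨fun _ _ _ => Subsingleton.elim _ _,
    fun y => ⟨fun _ => ⟨0, Subsingleton.elim _ _⟩, fun _ => Subsingleton.elim _ _⟩,
    fun _ => ⟨0, Subsingleton.elim _ _⟩⟩, fun i _ X => Subsingleton.elim _ _, hF⟩

/-- A nonzero element of a subfunctor is the class of some f outside the radical. Such f has a
section, and restricting along it puts the class of the identity, a generator, into the subfunctor.
-/
theorem simple_quot_rad {B : C} [IsLocalRing (End B)] :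
    Simple (FunMod.quot (homFunctor K B) (idealAct (rad K) (homFunctor K B) (fun _ => ⊤))
      (fun f x hx => res_mem_idealAct_rad _ f x hx)) := by
  set π := FunMod.quotπ (homFunctor K B) (idealAct (rad K) (homFunctor K B) (fun _ => ⊤))
      (fun f x hx => res_mem_idealAct_rad _ f x hx)
  have hsurj : ∀ X, Function.Surjective (FunMod.comp π X) := fun X =>
    Submodule.Quotient.mk_surjective _
  have hzero : ∀ {X} (f : X ⟶ B), FunMod.comp π X (FunMod.elt K X B f) = 0 ↔ f ∈ rad K X B :=
    fun {X} f => (Submodule.Quotient.mk_eq_zero _).trans elt_mem_rad_iff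
  refine ⟨fun {Y} m _ => ⟨fun hm h0 => ?_, fun hm => ?_⟩⟩
  · obtain ⟨n, -, hn⟩ := hm
    subst h0
    refine id_notMem_rad ((hzero (𝟙 B)).1 ?_)
    exact (congrArg (fun t => FunMod.comp t B (FunMod.comp π B (FunMod.elt K B B (𝟙 B))))
      hn).symm.trans (FunMod.comp_zero _ _ _ _)
  · obtain ⟨X, y, hy⟩ : ∃ X y, FunMod.comp m X y ≠ 0 := by
      by_contra! hcon
      exact hm (FunMod.hom_ext' hcon)
    obtain ⟨z, hz⟩ := hsurj X (FunMod.comp m X y)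
    obtain ⟨f, rfl⟩ := (FunMod.elt K X B).surjective z
    obtain ⟨g, hg⟩ := exists_section_of_notMem_rad (fun hf => hy (hz ▸ (hzero f).2 hf))
    have hone : FunMod.comp m B (Y.res g y) = FunMod.comp π B (FunMod.elt K B B (𝟙 B)) := by
      rw [FunMod.comp_res, ← hz, ← FunMod.comp_res, FunMod.res_elt, hg]
    refine FunMod.isIso_of_bijective m fun A => ⟨FunMod.injective_of_mono m A, fun s => ?_⟩
    obtain ⟨z, rfl⟩ := hsurj A s
    obtain ⟨h, rfl⟩ := (FunMod.elt K A B).surjective z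
    exact ⟨Y.res h (Y.res g y), by rw [FunMod.comp_res, hone, FunMod.comp_elt π A h]⟩

variable [HasFiniteBiproducts C]

/-- Here the assumption on simple functors is used: the projection onto the simple top is a minimal
cover with kernel the radical. -/
theorem isWeaklyKoszul_rad_of_isLocalRing (hC : IsWeaklyKoszulCategory K C) {B : C}
    [IsLocalRing (End B)] : IsWeaklyKoszul (radFunctor (homFunctor K B)) := by
  have hS := hC.simple _ (simple_quot_rad (K := K) (B := B))
  set π := FunMod.quotπ (homFunctor K B) (idealAct (rad K) (homFunctor K B) (fun _ => ⊤))
      (fun f x hx => res_mem_idealAct_rad _ f x hx)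
  have hker : ∀ X x, FunMod.comp π X x = 0 ↔
      x ∈ idealAct (rad K) (homFunctor K B) (fun _ => ⊤) X :=
    fun X x => Submodule.Quotient.mk_eq_zero _
  have hπ : IsMinimalCover π :=
    ⟨fun X => Submodule.Quotient.mk_surjective _, fun f hf => elt_mem_rad_iff.1 ((hker _ _).1 hf)⟩
  refine (hS.kernel hC.krullSchmidt hπ (κ := radι _) fun X => ⟨radι_injective _ X, fun x => ?_,
    hπ.surjective X⟩).2
  rw [hker, ← range_radι]
  rfl

/-- The radical is functorial and so preserves split sequences; these are rad-pure, and closure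
under middle terms applies. -/
theorem isWeaklyKoszul_rad_of_split (hC : IsKrullSchmidt C) {F₁ F₂ F₃ : FunMod K C} {i : F₁ ⟶ F₂}
    {ρ : F₂ ⟶ F₁} {q : F₂ ⟶ F₃} {σ : F₃ ⟶ F₂} (hi : i ≫ ρ = 𝟙 _) (hq : σ ≫ q = 𝟙 _)
    (hiq : i ≫ q = 0) (hsum : ρ ≫ i + q ≫ σ = 𝟙 _) (h₁ : IsWeaklyKoszul (radFunctor F₁))
    (h₃ : IsWeaklyKoszul (radFunctor F₃)) : IsWeaklyKoszul (radFunctor F₂) := by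
  obtain ⟨i', hi'⟩ := exists_radMap i
  obtain ⟨ρ', hρ'⟩ := exists_radMap ρ
  obtain ⟨q', hq'⟩ := exists_radMap q
  obtain ⟨σ', hσ'⟩ := exists_radMap σ
  have hr : i' ≫ ρ' = 𝟙 _ := radι_cancel (by
    rw [Category.assoc, hρ', reassoc_of% hi', hi, Category.comp_id, Category.id_comp])
  have hs : σ' ≫ q' = 𝟙 _ := radι_cancel (by
    rw [Category.assoc, hq', reassoc_of% hσ', hq, Category.comp_id, Category.id_comp])
  have hz : i' ≫ q' = 0 := radι_cancel (by
    rw [Category.assoc, hq', reassoc_of% hi', hiq, comp_zero, zero_comp])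
  have ht : ρ' ≫ i' + q' ≫ σ' = 𝟙 _ := radι_cancel (by
    rw [Preadditive.add_comp, Category.assoc, Category.assoc, hi', hσ', reassoc_of% hρ',
      reassoc_of% hq', ← Preadditive.comp_add, hsum, Category.comp_id, Category.id_comp])
  exact .middle hC (isShortExact_of_split hr hs hz ht) (isRadPure_of_retract hr) h₁ h₃

theorem isWeaklyKoszul_rad_biproduct (hC : IsWeaklyKoszulCategory K C) {n : ℕ} (Y : Fin n → C)
    (hY : ∀ i, IsLocalRing (End (Y i))) : IsWeaklyKoszul (radFunctor (homFunctor K (⨁ Y))) := by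
  induction n with
  | zero =>
    refine isWeaklyKoszul_of_subsingleton fun X => ⟨fun x y => radι_injective _ X ?_⟩
    obtain ⟨f, hf⟩ := (FunMod.elt K X (⨁ Y)).surjective (FunMod.comp (radι _) X x)
    obtain ⟨g, hg⟩ := (FunMod.elt K X (⨁ Y)).surjective (FunMod.comp (radι _) X y)
    rw [← hf, ← hg, biproduct.hom_ext f g fun j => j.elim0]
  | succ n ih =>
    have := hY 0
    refine isWeaklyKoszul_rad_of_split hC.krullSchmidt
      (i := FunMod.homMap (biproduct.ι Y 0)) (ρ := FunMod.homMap (biproduct.π Y 0))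
      (q := FunMod.homMap (biproduct.lift fun j : Fin n => biproduct.π Y j.succ))
      (σ := FunMod.homMap (biproduct.desc fun j : Fin n => biproduct.ι Y j.succ)) ?_ ?_ ?_ ?_
      (isWeaklyKoszul_rad_of_isLocalRing hC) (ih (fun j => Y j.succ) fun j => hY _)
    · rw [← FunMod.homMap_comp, biproduct.ι_π_self, FunMod.homMap_id]
    · rw [← FunMod.homMap_comp, ← FunMod.homMap_id]
      congr 1
      ext j k
      by_cases h : j = k
      · subst h
        simp
      · have h' : k.succ ≠ j.succ := fun e => h (Fin.succ_injective _ e).symm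
        simp [biproduct.ι_π_ne _ h', biproduct.ι_π_ne _ (Ne.symm h)]
    · rw [← FunMod.homMap_comp, ← FunMod.homMap_zero]
      congr 1
      ext k
      simp [biproduct.ι_π_ne _ (Fin.succ_ne_zero k).symm]
    · rw [← FunMod.homMap_comp, ← FunMod.homMap_comp, ← FunMod.homMap_add, biproduct.lift_desc,
        ← Fin.sum_univ_succ (fun j => biproduct.π Y j ≫ biproduct.ι Y j), biproduct.total,
        FunMod.homMap_id]

theorem isWeaklyKoszul_rad_homFunctor (hC : IsWeaklyKoszulCategory K C) (B : C) :
    IsWeaklyKoszul (radFunctor (homFunctor K B)) := by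
  obtain ⟨n, Y, hY, ⟨e⟩⟩ := hC.krullSchmidt B
  obtain ⟨s, hs⟩ := exists_radMap (FunMod.homMap (K := K) e.hom)
  obtain ⟨r, hr⟩ := exists_radMap (FunMod.homMap (K := K) e.inv)
  refine (isWeaklyKoszul_rad_biproduct hC Y hY).of_retract hC.krullSchmidt (s := s) (r := r)
    (radι_cancel ?_)
  rw [Category.assoc, hr, reassoc_of% hs, ← FunMod.homMap_comp, e.hom_inv_id, FunMod.homMap_id,
    Category.comp_id, Category.id_comp]

/-- Minimality puts the kernel Ω of the cover P → F inside rad P, with quotient rad F. -/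
theorem IsWeaklyKoszul.radFunctor (hC : IsWeaklyKoszulCategory K C) {F : FunMod K C}
    (hF : IsWeaklyKoszul F) : IsWeaklyKoszul (radFunctor F) := by
  obtain ⟨B, p, hp⟩ := exists_isMinimalCover hC.krullSchmidt hF.isFinitelyGenerated
  have hκ := isShortExact_kerι p hp.surjective
  obtain ⟨hgood, hΩ⟩ := hF.kernel hC.krullSchmidt hp hκ
  obtain ⟨a, ha⟩ := FunMod.exists_factor (radι _) (radι_injective _) (FunMod.kerι p) fun X x => by
    rw [range_radι]
    exact hp.kernel_mem hκ X x
  obtain ⟨b, hb⟩ := exists_radMap p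
  have ha' : ∀ X x, FunMod.comp (radι _) X (FunMod.comp a X x) =
      FunMod.comp (FunMod.kerι p) X x := fun X x => congrArg (fun t => FunMod.comp t X x) ha
  have hb' : ∀ X x, FunMod.comp (radι _) X (FunMod.comp b X x) =
      FunMod.comp p X (FunMod.comp (radι _) X x) :=
    fun X x => congrArg (fun t => FunMod.comp t X x) hb
  have hab : IsShortExact a b := fun X => by
    refine ⟨fun x y hxy => hκ.injective X ?_, fun y => ⟨fun hy => ?_, ?_⟩, fun z => ?_⟩
    · rw [← ha', ← ha', hxy]
    · obtain ⟨x, hx⟩ := (hκ.exact X (FunMod.comp (radι _) X y)).1 (by rw [← hb', hy, map_zero])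
      exact ⟨x, radι_injective _ X ((ha' X x).trans hx)⟩
    · rintro ⟨x, rfl⟩
      apply radι_injective _ X
      rw [hb', ha', hκ.comp_eq_zero, map_zero]
    · have hz := radι_mem F X z
      rw [← radPowSub_one] at hz
      obtain ⟨x, hx, hxz⟩ := exists_mem_radPowSub 1 p hp.surjective hz
      rw [radPowSub_one, ← range_radι] at hx
      obtain ⟨y, rfl⟩ := hx
      exact ⟨y, radι_injective _ X ((hb' X y).trans hxz)⟩
  refine .right hC.krullSchmidt hab (isRadPure_of_mem fun k hk X y hy => ?_) hΩ
    (isWeaklyKoszul_rad_homFunctor hC B)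
  -- The degree shift: rad^k of rad P is rad^(k+1) of P, so the required purity is literally
  -- goodness of the kernel.
  rw [← radι_mem_radPowSub_iff, ha'] at hy
  exact hgood.mem hκ.injective hk hy

end RadicalFunctor

end WeaklyKoszul

theorem mainTheorem9 {K : Type w} [Field K] {C : Type u} [Category.{v} C] [Preadditive C]
    [Linear K C] [HasFiniteBiproducts C] [IsIdempotentComplete C] [EssentiallySmall.{v} C]
    (hC : WeaklyKoszul.IsWeaklyKoszulCategory K C) :
    (∀ (F₁ F₂ F₃ : WeaklyKoszul.FunMod K C) (a : F₁ ⟶ F₂) (b : F₂ ⟶ F₃),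
      WeaklyKoszul.IsFinitelyPresented F₁ →
      WeaklyKoszul.IsFinitelyPresented F₂ →
      WeaklyKoszul.IsFinitelyPresented F₃ →
      WeaklyKoszul.IsShortExact a b →
      (∀ (k : ℕ) (X : C),
        WeaklyKoszul.radPowSub k F₂ X ⊓ LinearMap.range (WeaklyKoszul.FunMod.comp a X) =
          (WeaklyKoszul.radPowSub k F₁ X).map (WeaklyKoszul.FunMod.comp a X)) →
      WeaklyKoszul.IsWeaklyKoszul F₁ →
      WeaklyKoszul.IsWeaklyKoszul F₂ →
      WeaklyKoszul.IsWeaklyKoszul F₃) ∧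
    (∀ F : WeaklyKoszul.FunMod K C, WeaklyKoszul.IsWeaklyKoszul F →
      WeaklyKoszul.IsWeaklyKoszul (WeaklyKoszul.radFunctor F) ∧
        WeaklyKoszul.IsFinitelyGenerated (WeaklyKoszul.radFunctor F)) :=
  ⟨fun _ _ _ _ _ _ _ _ hab ha h₁ h₂ => h₁.right hC.krullSchmidt hab ha h₂,
    fun _ hF => ⟨hF.radFunctor hC, (hF.radFunctor hC).isFinitelyGenerated⟩⟩
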